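/- Let $(P,\Pi)$ be a Poisson manifold, i.e. a finite-dimensional smooth manifold $P$ (Hausdorff and second countable) with a smooth bivector field $\Pi$ whose Schouten bracket satisfies $[\Pi,\Pi]=0$, and let $\sharp\colon T^*P\to TP$ be the contraction with $\Pi$. For an (embedded) submanifold $S\subset P$ let $N^*S\subset T^*P|_S$ denote the annihilator of $TS$. A submanifold $S$ is called cosymplectic if $T_pS\oplus\sharp N_p^*S=T_pP$ for all $p\in S$; such an $S$ carries an induced bivector with sharp map $\sharp_S\colon T_p^*S\to T_pS$, $\sharp_S\tilde\xi=\sharp\xi$, where $\xi\in T_p^*P$ is the extension of $\tilde\xi$ that annihilates $\sharp N_p^*S$. A submanifold $C\subset P$ contained in $S$ is coisotropic in $S$ if $\sharp_S$ maps the annihilator of $T_pC$ in $T_p^*S$ into $T_pC$, for all $p\in C$. Let $C$ be a pre-Poisson submanifold of $(P,\Pi)$, i.e. an embedded submanifold such that the rank of $TC+\sharp N^*C$ is constant along $C$. Then there exists a cosymplectic submanifold $\tilde P$ of $P$ that contains $C$ and in which $C$ is coisotropic. -/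

import Mathlib

open scoped Manifold ContDiff

noncomputable section

/-! ### Poisson vector spaces -/

namespace PoissonLinear

variable {V : Type*} [AddCommGroup V] [Module ℝ V]

/-- The contraction `♯ : V* → V` with a bivector `B` on a finite-dimensional space `V`, the
bivector being regarded as a bilinear form on `V*`: `♯ξ` is the vector with
`η (♯ξ) = B ξ η` for all `η`. -/
def sharp [FiniteDimensional ℝ V] (B : Module.Dual ℝ V →ₗ[ℝ] Module.Dual ℝ V →ₗ[ℝ] ℝ) :
    Module.Dual ℝ V →ₗ[ℝ] V :=
  (Module.evalEquiv ℝ V).symm.toLinearMap ∘ₗ B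

theorem apply_sharp [FiniteDimensional ℝ V]
    (B : Module.Dual ℝ V →ₗ[ℝ] Module.Dual ℝ V →ₗ[ℝ] ℝ) (ξ η : Module.Dual ℝ V) :
    η (sharp B ξ) = B ξ η := by
  simp [sharp]

/-- The sharp map of a bivector: `ξ (♯ξ) = 0`. -/
def IsSkew (s : Module.Dual ℝ V →ₗ[ℝ] V) : Prop :=
  ∀ ξ : Module.Dual ℝ V, ξ (s ξ) = 0

theorem IsSkew.apply_eq_neg {s : Module.Dual ℝ V →ₗ[ℝ] V} (hs : IsSkew s)
    (ξ η : Module.Dual ℝ V) : η (s ξ) = -ξ (s η) := by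
  have h := hs (ξ + η)
  simp only [map_add, LinearMap.add_apply, hs ξ, hs η] at h
  linarith

/-- The subspace `♯ W°`. -/
def sharpAnn (s : Module.Dual ℝ V →ₗ[ℝ] V) (W : Submodule ℝ V) : Submodule ℝ V :=
  W.dualAnnihilator.map s

/-- `W` is coisotropic if `♯ W° ⊆ W`. -/
def IsCoisotropic (s : Module.Dual ℝ V →ₗ[ℝ] V) (W : Submodule ℝ V) : Prop :=
  sharpAnn s W ≤ W

/-- `W` is cosymplectic if `V = W ⊕ ♯ W°`. -/
def IsCosymplectic (s : Module.Dual ℝ V →ₗ[ℝ] V) (W : Submodule ℝ V) : Prop :=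
  IsCompl W (sharpAnn s W)

/-- The extension of `ξ ∈ W*` to `V` that annihilates `♯ W°`. -/
def extendCovector {s : Module.Dual ℝ V →ₗ[ℝ] V} {W : Submodule ℝ V}
    (hW : IsCosymplectic s W) : Module.Dual ℝ W →ₗ[ℝ] Module.Dual ℝ V :=
  (W.projectionOnto (sharpAnn s W) hW).dualMap

theorem sharp_extendCovector_mem {s : Module.Dual ℝ V →ₗ[ℝ] V} (hs : IsSkew s)
    {W : Submodule ℝ V} (hW : IsCosymplectic s W) (ξ : Module.Dual ℝ W) :
    s (extendCovector hW ξ) ∈ W := by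
  rw [← Subspace.forall_mem_dualAnnihilator_apply_eq_zero_iff]
  intro η hη
  rw [hs.apply_eq_neg]
  have h : s η ∈ sharpAnn s W := ⟨η, hη, rfl⟩
  simp [extendCovector, (Submodule.projectionOnto_apply_eq_zero_iff hW).2 h]

/-- The sharp map `♯_W : W* → W` of the bivector induced on a cosymplectic subspace `W`:
`♯_W ξ = ♯ ξ'`, where `ξ'` is the extension of `ξ` that annihilates `♯ W°`. -/
def inducedSharp {s : Module.Dual ℝ V →ₗ[ℝ] V} (hs : IsSkew s)
    {W : Submodule ℝ V} (hW : IsCosymplectic s W) : Module.Dual ℝ W →ₗ[ℝ] W :=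
  (s ∘ₗ extendCovector hW).codRestrict W (sharp_extendCovector_mem hs hW)

end PoissonLinear

/-! ### Embedded submanifolds -/

section Submanifold

variable {E : Type*} [NormedAddCommGroup E] [NormedSpace ℝ E]
  {P : Type*} [TopologicalSpace P] [ChartedSpace E P]

/-- `φ` is a smooth chart of `P` around `p` in which `S` is the linear subspace `F`. -/
structure IsSliceChart (S : Set P) (p : P) (φ : OpenPartialHomeomorph P E)
    (F : Submodule ℝ E) : Prop where
  mem_maximalAtlas : φ ∈ IsManifold.maximalAtlas 𝓘(ℝ, E) ∞ P
  mem_source : p ∈ φ.source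
  mem_iff : ∀ q ∈ φ.source, q ∈ S ↔ φ q ∈ F

variable (E) in
/-- `S` is an embedded submanifold of dimension `k`, not necessarily closed. -/
def IsEmbeddedSubmanifold (S : Set P) (k : ℕ) : Prop :=
  ∀ p ∈ S, ∃ (φ : OpenPartialHomeomorph P E) (F : Submodule ℝ E),
    IsSliceChart S p φ F ∧ Module.finrank ℝ F = k

variable (E) in
/-- The tangent space `T_p S ⊆ T_p P` of an embedded submanifold `S` at a point `p` of `S`: the
vectors that are tangent to `S` in the slice charts around `p`. All slice charts give the same
subspace, see `submanifoldTangent_eq`. -/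
def submanifoldTangent (S : Set P) (p : P) : Submodule ℝ (TangentSpace 𝓘(ℝ, E) p) :=
  ⨅ (φ : OpenPartialHomeomorph P E) (F : Submodule ℝ E) (_ : IsSliceChart S p φ F),
    F.comap (mfderiv 𝓘(ℝ, E) 𝓘(ℝ, E) φ p).toLinearMap

/-- Two slice charts define the same tangent vectors. -/
theorem IsSliceChart.mem_of_mem [IsManifold 𝓘(ℝ, E) ∞ P] [FiniteDimensional ℝ E] {S : Set P}
    {p : P} (hp : p ∈ S) {φ ψ : OpenPartialHomeomorph P E} {F G : Submodule ℝ E}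
    (hφ : IsSliceChart S p φ F) (hψ : IsSliceChart S p ψ G) {v : TangentSpace 𝓘(ℝ, E) p}
    (hv : mfderiv 𝓘(ℝ, E) 𝓘(ℝ, E) φ p v ∈ F) : mfderiv 𝓘(ℝ, E) 𝓘(ℝ, E) ψ p v ∈ G := by
  have h1 : (1 : WithTop ℕ∞) ≤ ∞ := by norm_cast
  have hφ1 := IsManifold.maximalAtlas_subset_of_le h1 hφ.mem_maximalAtlas
  have hψ1 := IsManifold.maximalAtlas_subset_of_le h1 hψ.mem_maximalAtlas
  have hφd := mdifferentiableAt_of_mem_maximalAtlas hφ1 hφ.mem_source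
  have hψd := mdifferentiableAt_of_mem_maximalAtlas hψ1 hψ.mem_source
  have hsd := mdifferentiableAt_symm_of_mem_maximalAtlas hφ1 (φ.map_source hφ.mem_source)
  set g : E → E := ψ ∘ φ.symm with hg
  have hψd' : MDifferentiableAt 𝓘(ℝ, E) 𝓘(ℝ, E) ψ (φ.symm (φ p)) := by
    rwa [φ.left_inv hφ.mem_source]
  have hgd : DifferentiableAt ℝ g (φ p) :=
    mdifferentiableAt_iff_differentiableAt.1 (hψd'.comp (φ p) hsd)
  have hchain : fderiv ℝ g (φ p) (mfderiv 𝓘(ℝ, E) 𝓘(ℝ, E) φ p v) =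
      mfderiv 𝓘(ℝ, E) 𝓘(ℝ, E) ψ p v := by
    have hgd' : MDifferentiableAt 𝓘(ℝ, E) 𝓘(ℝ, E) g (φ p) := hψd'.comp (φ p) hsd
    have h2 := mfderiv_comp p hgd' hφd
    have h3 : mfderiv 𝓘(ℝ, E) 𝓘(ℝ, E) (g ∘ φ) p = mfderiv 𝓘(ℝ, E) 𝓘(ℝ, E) ψ p := by
      apply Filter.EventuallyEq.mfderiv_eq
      filter_upwards [φ.open_source.mem_nhds hφ.mem_source] with q hq
      simp [hg, φ.left_inv hq]
    rw [← h3, h2, mfderiv_eq_fderiv]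
    rfl
  set w : E := mfderiv 𝓘(ℝ, E) 𝓘(ℝ, E) φ p v with hw
  have hline : HasDerivAt (fun t : ℝ ↦ φ p + t • w) w 0 := by
    simpa using ((hasDerivAt_id (0 : ℝ)).smul_const w).const_add (φ p)
  have hcurve : HasDerivAt (fun t : ℝ ↦ g (φ p + t • w)) (fderiv ℝ g (φ p) w) 0 := by
    have hgd0 : HasFDerivAt g (fderiv ℝ g (φ p)) (φ p + (0 : ℝ) • w) := by
      simpa using hgd.hasFDerivAt
    exact hgd0.comp_hasDerivAt 0 hline
  have hcont : Filter.Tendsto (fun t : ℝ ↦ φ p + t • w) (nhds 0) (nhds (φ p)) := by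
    simpa using hline.continuousAt.tendsto
  have hmem : ∀ᶠ t : ℝ in nhds 0, g (φ p + t • w) ∈ G := by
    have ht := hcont.eventually (φ.open_target.mem_nhds (φ.map_source hφ.mem_source))
    have hs : ContinuousAt φ.symm (φ p) := φ.continuousAt_symm (φ.map_source hφ.mem_source)
    have hs' : Filter.Tendsto (fun t : ℝ ↦ φ.symm (φ p + t • w)) (nhds 0) (nhds p) := by
      have := hs.tendsto.comp hcont
      rwa [φ.left_inv hφ.mem_source] at this
    filter_upwards [ht, hs'.eventually (ψ.open_source.mem_nhds hψ.mem_source)] with t h4 h5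
    refine (hψ.mem_iff _ h5).1 ((hφ.mem_iff _ (φ.map_target h4)).2 ?_)
    rw [φ.right_inv h4]
    exact F.add_mem ((hφ.mem_iff p hφ.mem_source).1 hp) (F.smul_mem t hv)
  rw [← hchain]
  have hclosed : IsClosed (G : Set E) := G.closed_of_finiteDimensional
  have hslope := hcurve.tendsto_slope_zero
  refine hclosed.mem_of_tendsto hslope ?_
  filter_upwards [hmem.filter_mono nhdsWithin_le_nhds] with t ht
  refine G.smul_mem _ (G.sub_mem (by simpa using ht) ?_)
  simpa using hmem.self_of_nhds

theorem submanifoldTangent_eq [IsManifold 𝓘(ℝ, E) ∞ P] [FiniteDimensional ℝ E] {S : Set P}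
    {p : P} (hp : p ∈ S) {φ : OpenPartialHomeomorph P E} {F : Submodule ℝ E}
    (hφ : IsSliceChart S p φ F) :
    submanifoldTangent E S p = F.comap (mfderiv 𝓘(ℝ, E) 𝓘(ℝ, E) φ p).toLinearMap := by
  apply le_antisymm
  · exact iInf_le_of_le φ (iInf_le_of_le F (iInf_le_of_le hφ le_rfl))
  · exact le_iInf fun ψ ↦ le_iInf fun G ↦ le_iInf fun hψ v hv ↦ hφ.mem_of_mem hp hψ hv

end Submanifold

/-! ### Poisson manifolds -/

section Poisson

variable (E : Type*) [NormedAddCommGroup E] [NormedSpace ℝ E]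
  (P : Type*) [TopologicalSpace P] [ChartedSpace E P]

variable {P} in
/-- The covector field `d (ξ ∘ φ)` near `p`, where `φ` is the preferred chart at `p`: the covector
field with the constant coefficients `ξ` in this chart. -/
def chartCovector (p : P) (ξ : Module.Dual ℝ E) (q : P) :
    Module.Dual ℝ (TangentSpace 𝓘(ℝ, E) q) :=
  ξ ∘ₗ (mfderiv 𝓘(ℝ, E) 𝓘(ℝ, E) (chartAt E p) q).toLinearMap

/-- A smooth bivector field on `P`: a field of alternating bilinear forms on the cotangent spaces
whose coefficients in charts are smooth. -/
structure BivectorField where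
  toFun (p : P) : Module.Dual ℝ (TangentSpace 𝓘(ℝ, E) p) →ₗ[ℝ]
    Module.Dual ℝ (TangentSpace 𝓘(ℝ, E) p) →ₗ[ℝ] ℝ
  alternating (p : P) (ξ : Module.Dual ℝ (TangentSpace 𝓘(ℝ, E) p)) : toFun p ξ ξ = 0
  contMDiffOn (p : P) (ξ η : Module.Dual ℝ E) : ContMDiffOn 𝓘(ℝ, E) 𝓘(ℝ, ℝ) ∞
    (fun q ↦ toFun q (chartCovector E p ξ q) (chartCovector E p η q)) (chartAt E p).source

variable {E P}

instance [FiniteDimensional ℝ E] (p : P) : FiniteDimensional ℝ (TangentSpace 𝓘(ℝ, E) p) :=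
  inferInstanceAs (FiniteDimensional ℝ E)

namespace BivectorField

variable [FiniteDimensional ℝ E]

/-- The contraction `♯ : T_p* P → T_p P` with a bivector field. -/
def sharp (B : BivectorField E P) (p : P) :
    Module.Dual ℝ (TangentSpace 𝓘(ℝ, E) p) →ₗ[ℝ] TangentSpace 𝓘(ℝ, E) p :=
  PoissonLinear.sharp (B.toFun p)

theorem isSkew_sharp (B : BivectorField E P) (p : P) : PoissonLinear.IsSkew (B.sharp p) := by
  intro ξ
  rw [sharp, PoissonLinear.apply_sharp]
  exact B.alternating p ξ

/-- The trivector `[B, B]` at `p` for the Schouten bracket, evaluated on three covectors with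
coefficients `ξ`, `η`, `ζ` in the preferred chart at `p`. In coordinates,
`[B, B]^{ijk} = 2 ∑_l (B^{il} ∂_l B^{jk} + B^{jl} ∂_l B^{ki} + B^{kl} ∂_l B^{ij})`, up to a sign
that depends on conventions. -/
def schoutenSquare (B : BivectorField E P) (p : P) (ξ η ζ : Module.Dual ℝ E) : ℝ :=
  let coeff (α β : Module.Dual ℝ E) (q : P) : ℝ :=
    B.toFun q (chartCovector E p α q) (chartCovector E p β q)
  let D (α β γ : Module.Dual ℝ E) : ℝ :=
    mfderiv 𝓘(ℝ, E) 𝓘(ℝ, ℝ) (coeff β γ) p (B.sharp p (chartCovector E p α p))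
  2 * (D ξ η ζ + D η ζ ξ + D ζ ξ η)

end BivectorField

variable (E P) in
/-- A Poisson structure on `P`: a smooth bivector field `B` with `[B, B] = 0`. -/
structure PoissonStructure [FiniteDimensional ℝ E] extends BivectorField E P where
  schouten_eq_zero (p : P) (ξ η ζ : Module.Dual ℝ E) :
    toBivectorField.schoutenSquare p ξ η ζ = 0

namespace PoissonStructure

variable [FiniteDimensional ℝ E]

/-- `♯ N_p* S`, where the conormal space `N_p* S` is the annihilator of `T_p S` in `T_p* P`. -/
def sharpConormal (B : PoissonStructure E P) (S : Set P) (p : P) :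
    Submodule ℝ (TangentSpace 𝓘(ℝ, E) p) :=
  PoissonLinear.sharpAnn (B.sharp p) (submanifoldTangent E S p)

/-- A submanifold `S` is pre-Poisson if `TS + ♯ N*S` has constant rank along `S`. -/
def IsPrePoisson (B : PoissonStructure E P) (S : Set P) : Prop :=
  ∃ r : ℕ, ∀ p ∈ S, Module.finrank ℝ ↥(submanifoldTangent E S p ⊔ B.sharpConormal S p) = r

/-- A submanifold `S` is cosymplectic if `T_p P = T_p S ⊕ ♯ N_p* S` for all points `p` of `S`. -/
def IsCosymplectic (B : PoissonStructure E P) (S : Set P) : Prop :=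
  ∀ p ∈ S, PoissonLinear.IsCosymplectic (B.sharp p) (submanifoldTangent E S p)

/-- For a cosymplectic submanifold `S`, the sharp map `T_p* S → T_p S` of the Poisson structure
induced on `S`. -/
def submanifoldSharp (B : PoissonStructure E P) {S : Set P} (hS : B.IsCosymplectic S)
    (p : P) (hp : p ∈ S) :
    Module.Dual ℝ (submanifoldTangent E S p) →ₗ[ℝ] submanifoldTangent E S p :=
  PoissonLinear.inducedSharp (B.isSkew_sharp p) (hS p hp)

/-- A submanifold `C` of `P` that is contained in a cosymplectic submanifold `S` is coisotropic
in `S` if `♯_S` maps the annihilator of `T_p C` in `T_p* S` into `T_p C`, for all points `p`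
of `C`. -/
def IsCoisotropicIn (B : PoissonStructure E P) {C S : Set P} (hCS : C ⊆ S)
    (hS : B.IsCosymplectic S) : Prop :=
  ∀ (p : P) (hp : p ∈ C), PoissonLinear.IsCoisotropic (B.submanifoldSharp hS p (hCS hp))
    ((submanifoldTangent E C p).comap (submanifoldTangent E S p).subtype)

end PoissonStructure

end Poisson
end

/-! Linear core. Let `W = T_pC`, and let `K` be the kernel of the bivector on `W°`; it equals `(W +
♯W°)°`. If `T°` is a complement of `K` in `W°`, the bivector is nondegenerate on `T°`, so `T` is
cosymplectic. A covector on `T` that kills `W` extends to some `ξ ∈ W°` with `♯ξ ∈ T`. Then `♯ξ`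
pairs to zero with `T°` and with `K`, hence with `W°`, so `♯ξ ∈ W`: `W` is coisotropic in `T`. It
remains to find a submanifold `S ⊇ C` whose tangent spaces along `C` are such `T`, that is, to
thicken `C` in directions complementary to `TC + ♯N*C`. Being cosymplectic is an open condition, so
shrinking `S` around `C` finishes the proof (`IsSliceChart.eventually_isCosymplectic`).

To build `S` (`PoissonStructure.IsPrePoisson.exists_extension`), a neighbourhood of `C` is immersed
in a Hilbert space `H` by a map `Φ`. Pushing the bivector forward and compressing it to the
orthogonal complement of `dΦ(TC)` gives a skew operator `A`. Pulling its range back by `dΦ` gives a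
complement of `K`, and the pre-Poisson condition says exactly that `A` has constant rank along `C`.
So the projections to the ranges of `A` vary smoothly. Composed with local retractions to `C` and
averaged by a partition of unity, they extend to a neighbourhood as a field `M`; the averages need
not be idempotent and are corrected by `σ` from `exists_idempotent_correction`. With `f` the average
of `Φ - Φ ∘ retract`, `S` is the zero set of `σ(M) f`. At `p ∈ C`, its linearization is the
projection to the range of `A p` after `dΦ`, so the regular value theorem gives slice charts with
the desired tangent spaces. -/

noncomputable section

/-! ### Linear algebra of cosymplectic and coisotropic subspaces. -/

namespace PoissonLinear

variable {V : Type*} [AddCommGroup V] [Module ℝ V]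

/-- The kernel of the restriction of the bivector to `W°`. -/
def conormalKernel (s : Module.Dual ℝ V →ₗ[ℝ] V) (W : Submodule ℝ V) :
    Submodule ℝ (Module.Dual ℝ V) :=
  W.dualAnnihilator ⊓ (sharpAnn s W).dualAnnihilator

theorem mem_conormalKernel {s : Module.Dual ℝ V →ₗ[ℝ] V} {W : Submodule ℝ V}
    {ξ : Module.Dual ℝ V} :
    ξ ∈ conormalKernel s W ↔
      ξ ∈ W.dualAnnihilator ∧ ∀ η ∈ W.dualAnnihilator, ξ (s η) = 0 := by
  simp [conormalKernel, sharpAnn, Submodule.mem_dualAnnihilator]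

/-- The kernel is the annihilator of `W + ♯W°`. This is how the pre-Poisson condition becomes a
constant-rank condition on the bivector restricted to `N*C`. -/
theorem finrank_conormalKernel [FiniteDimensional ℝ V] (s : Module.Dual ℝ V →ₗ[ℝ] V)
    (W : Submodule ℝ V) :
    Module.finrank ℝ (conormalKernel s W) + Module.finrank ℝ ↥(W ⊔ sharpAnn s W) =
      Module.finrank ℝ V := by
  rw [conormalKernel, ← Submodule.dualAnnihilator_sup_eq, add_comm,
    Subspace.finrank_add_finrank_dualAnnihilator_eq]

/-- A subspace is cosymplectic if the restriction of the bivector to its annihilator is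
nondegenerate. -/
theorem isCosymplectic_of_nondegenerate [FiniteDimensional ℝ V] {s : Module.Dual ℝ V →ₗ[ℝ] V}
    {T : Submodule ℝ V} (h : ∀ ξ ∈ T.dualAnnihilator, s ξ ∈ T → ξ = 0) : IsCosymplectic s T := by
  have hinj : Function.Injective (s.domRestrict T.dualAnnihilator) := by
    refine (injective_iff_map_eq_zero _).2 ?_
    rintro ⟨ξ, hξ⟩ h0
    have h0' : s ξ = 0 := h0
    exact Subtype.ext (h ξ hξ (h0' ▸ T.zero_mem))
  have hfin : Module.finrank ℝ (sharpAnn s T) = Module.finrank ℝ T.dualAnnihilator := by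
    rw [← LinearMap.finrank_range_of_inj hinj, LinearMap.range_domRestrict]
    rfl
  have hdisj : Disjoint T (sharpAnn s T) := by
    rw [Submodule.disjoint_def]
    rintro _ hT ⟨ξ, hξ, rfl⟩
    rw [h ξ hξ hT, map_zero]
  refine ⟨hdisj, codisjoint_iff.2 (Submodule.eq_top_of_finrank_eq ?_)⟩
  have h1 := Submodule.finrank_sup_add_finrank_inf_eq T (sharpAnn s T)
  rw [hdisj.eq_bot, finrank_bot, hfin, Subspace.finrank_add_finrank_dualAnnihilator_eq] at h1
  simpa using h1

/-- Converse of `isCosymplectic_of_nondegenerate`: the splitting forces `dim ♯T° = dim T°`, so `♯`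
is injective on `T°`. -/
theorem IsCosymplectic.eq_zero [FiniteDimensional ℝ V] {s : Module.Dual ℝ V →ₗ[ℝ] V}
    {T : Submodule ℝ V} (h : IsCosymplectic s T) {ξ : Module.Dual ℝ V}
    (hξ : ξ ∈ T.dualAnnihilator) (hs : s ξ ∈ T) : ξ = 0 := by
  have hz : s ξ = 0 := (Submodule.disjoint_def.1 h.disjoint) _ hs ⟨ξ, hξ, rfl⟩
  have h1 := Submodule.finrank_sup_add_finrank_inf_eq T (sharpAnn s T)
  rw [h.disjoint.eq_bot, h.codisjoint.eq_top, finrank_bot, finrank_top,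
    ← Subspace.finrank_add_finrank_dualAnnihilator_eq T] at h1
  have hfin : Module.finrank ℝ (LinearMap.range (s.domRestrict T.dualAnnihilator)) =
      Module.finrank ℝ T.dualAnnihilator := by
    rw [LinearMap.range_domRestrict]
    change Module.finrank ℝ (sharpAnn s T) = _
    lia
  have h2 := LinearMap.finrank_range_add_finrank_ker (K := ℝ) (V := T.dualAnnihilator)
    (s.domRestrict T.dualAnnihilator)
  have hker : LinearMap.ker (s.domRestrict T.dualAnnihilator) = ⊥ := by
    exact Submodule.finrank_eq_zero (R := ℝ) (M := T.dualAnnihilator).1 (by lia)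
  have := (LinearMap.ker_eq_bot'.1 hker) ⟨ξ, hξ⟩ hz
  exact congrArg Subtype.val this

section Complement

variable {s : Module.Dual ℝ V →ₗ[ℝ] V} {W T : Submodule ℝ V}

/-- If `T°` is a complement in `W°` of the kernel of the bivector on `W°`, then `T` is
cosymplectic. -/
theorem isCosymplectic_of_complement [FiniteDimensional ℝ V] (hs : IsSkew s)
    (hinf : T.dualAnnihilator ⊓ conormalKernel s W = ⊥)
    (hsup : T.dualAnnihilator ⊔ conormalKernel s W = W.dualAnnihilator) :
    IsCosymplectic s T := by
  refine isCosymplectic_of_nondegenerate fun ξ hξ hsξ ↦ ?_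
  have hξW : ξ ∈ W.dualAnnihilator := hsup ▸ Submodule.mem_sup_left hξ
  -- `♯ξ` pairs to zero with `T°` because it lies in `T`, and with the kernel because `ξ ∈ W°`.
  -- These two span `W°`, so `ξ` is itself in the kernel.
  have : ξ ∈ T.dualAnnihilator ⊓ conormalKernel s W := by
    refine ⟨hξ, mem_conormalKernel.2 ⟨hξW, fun η hη ↦ ?_⟩⟩
    rw [hs.apply_eq_neg, neg_eq_zero]
    rw [← hsup] at hη
    obtain ⟨t, ht, κ, hκ, rfl⟩ := Submodule.mem_sup.1 hη
    rw [LinearMap.add_apply, (Submodule.mem_dualAnnihilator _).1 ht _ hsξ,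
      (mem_conormalKernel.1 hκ).2 ξ hξW, add_zero]
  simpa [hinf] using this

/-- In the situation of `isCosymplectic_of_complement`, `W` is coisotropic in `T`. -/
theorem isCoisotropic_of_complement [FiniteDimensional ℝ V] (hs : IsSkew s)
    (hsup : T.dualAnnihilator ⊔ conormalKernel s W = W.dualAnnihilator)
    (hT : IsCosymplectic s T) :
    IsCoisotropic (inducedSharp hs hT) (W.comap T.subtype) := by
  have hWT : W ≤ T := by
    rw [← Subspace.dualAnnihilator_le_dualAnnihilator_iff, ← hsup]
    exact le_sup_left
  rintro _ ⟨ξ, hξ, rfl⟩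
  change s (extendCovector hT ξ) ∈ W
  have hext (v : V) (hv : v ∈ T) : extendCovector hT ξ v = ξ ⟨v, hv⟩ := by
    change ξ (T.projectionOnto _ hT v) = _
    congr 1
    exact Submodule.projectionOnto_apply_left hT ⟨v, hv⟩
  have hN : extendCovector hT ξ ∈ W.dualAnnihilator := by
    rw [Submodule.mem_dualAnnihilator]
    intro w hw
    rw [hext w (hWT hw)]
    exact (Submodule.mem_dualAnnihilator _).1 hξ ⟨w, hWT hw⟩ hw
  -- Test against `η = t + κ`: `t ∈ T°` vanishes because the sharp of the extension lies in `T`, and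
  -- `κ` because the extension lies in `W°`.
  rw [← Subspace.forall_mem_dualAnnihilator_apply_eq_zero_iff]
  intro η hη
  rw [← hsup] at hη
  obtain ⟨t, ht, κ, hκ, rfl⟩ := Submodule.mem_sup.1 hη
  rw [LinearMap.add_apply, (mem_conormalKernel.1 hκ).2 _ hN,
    (Submodule.mem_dualAnnihilator _).1 ht _ (sharp_extendCovector_mem hs hT ξ), add_zero]

end Complement

/-! ### Operators on a Hilbert space that represent the bivector on `W°`. -/

section Hilbert

variable {H : Type*} [NormedAddCommGroup H] [InnerProductSpace ℝ H]

/-- The pullback `⟪h, J ·⟫` to `V` of the covector on `H` dual to `h`. -/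
def pullbackInner (J : V →ₗ[ℝ] H) : H →ₗ[ℝ] Module.Dual ℝ V :=
  J.dualMap ∘ₗ innerₗ H

@[simp]
theorem pullbackInner_apply (J : V →ₗ[ℝ] H) (h : H) (v : V) :
    pullbackInner J h v = inner ℝ h (J v) := rfl

theorem pullbackInner_surjective [FiniteDimensional ℝ V] {J : V →ₗ[ℝ] H}
    (hJ : Function.Injective J) : Function.Surjective (pullbackInner J) := by
  rw [← LinearMap.range_eq_top, ← Subspace.dualCoannihilator_dualAnnihilator_eq (W := LinearMap.range _),
    ← Submodule.dualAnnihilator_bot]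
  congr 1
  rw [eq_bot_iff]
  intro v hv
  rw [Submodule.mem_dualCoannihilator] at hv
  have h := hv _ ⟨J v, rfl⟩
  rw [pullbackInner_apply, inner_self_eq_zero] at h
  exact hJ (by rw [h, map_zero])

theorem pullbackInner_mem_dualAnnihilator {J : V →ₗ[ℝ] H} {W : Submodule ℝ V} {h : H} :
    pullbackInner J h ∈ W.dualAnnihilator ↔ h ∈ (W.map J)ᗮ := by
  rw [Submodule.mem_dualAnnihilator, Submodule.mem_orthogonal']
  simp

variable [FiniteDimensional ℝ V] {s : Module.Dual ℝ V →ₗ[ℝ] V} {J : V →ₗ[ℝ] H}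
  {T W : Submodule ℝ V} {A : H →L[ℝ] H}

/-- `A` represents the form that the bivector with sharp map `s` induces on the orthogonal
complement of `J W`, extended by zero to `J W`. -/
structure Represents (s : Module.Dual ℝ V →ₗ[ℝ] V) (J : V →ₗ[ℝ] H) (W : Submodule ℝ V)
    (A : H →L[ℝ] H) : Prop where
  inner_eq : ∀ h ∈ (W.map J)ᗮ, ∀ h' ∈ (W.map J)ᗮ,
    inner ℝ (A h) h' = pullbackInner J h' (s (pullbackInner J h))
  apply_eq_zero : ∀ h ∈ W.map J, A h = 0
  apply_mem : ∀ h, A h ∈ (W.map J)ᗮ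

namespace Represents

/-- Covectors in `W°` are the pullbacks of vectors in `(J W)ᗮ`, where `A` is the form; since `A h`
lies there too, it may be used as the test vector. -/
theorem apply_eq_zero_iff (hA : Represents s J W A) (hs : IsSkew s) (hJ : Function.Injective J)
    {h : H} (hh : h ∈ (W.map J)ᗮ) : A h = 0 ↔ pullbackInner J h ∈ conormalKernel s W := by
  rw [mem_conormalKernel, and_iff_right (pullbackInner_mem_dualAnnihilator.2 hh)]
  constructor
  · intro h0 η hη
    obtain ⟨h', rfl⟩ := pullbackInner_surjective hJ η
    rw [hs.apply_eq_neg, ← hA.inner_eq h hh h' (pullbackInner_mem_dualAnnihilator.1 hη), h0,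
      inner_zero_left, neg_zero]
  · intro h0
    rw [← inner_self_eq_zero (𝕜 := ℝ), hA.inner_eq h hh _ (hA.apply_mem h), hs.apply_eq_neg,
      h0 _ (pullbackInner_mem_dualAnnihilator.2 (hA.apply_mem h)), neg_zero]

theorem exists_orthogonal (hA : Represents s J W A) (h : H) :
    ∃ h' ∈ (W.map J)ᗮ, A h' = A h := by
  obtain ⟨y, hy, z, hz, rfl⟩ := (W.map J).exists_add_mem_mem_orthogonal h
  exact ⟨z, hz, by rw [map_add, hA.apply_eq_zero y hy, zero_add]⟩

/-- Range and kernel of a skew operator are orthogonal: if `A (A h') = 0`, then `‖A h'‖² = -⟪A (A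
h'), h'⟫ = 0`. This makes the pulled-back range of `A` transverse to the conormal kernel. -/
theorem eq_zero_of_mem (hA : Represents s J W A) (hs : IsSkew s) (hJ : Function.Injective J)
    {h : H} (hh : h ∈ LinearMap.range A.toLinearMap)
    (hK : pullbackInner J h ∈ conormalKernel s W) : h = 0 := by
  obtain ⟨h₁, rfl⟩ := hh
  obtain ⟨h', hh', he⟩ := hA.exists_orthogonal h₁
  have hK' : A (A h₁) = 0 := (hA.apply_eq_zero_iff hs hJ (hA.apply_mem h₁)).2 hK
  change A h₁ = 0
  rw [← he] at hK' ⊢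
  rw [← inner_self_eq_zero (𝕜 := ℝ), hA.inner_eq h' hh' _ (hA.apply_mem h'), hs.apply_eq_neg,
    ← hA.inner_eq _ (hA.apply_mem h') h' hh', hK', inner_zero_left, neg_zero]

/-- `H` may be infinite-dimensional and `pullbackInner J` need not be injective, but `A` kills the
ambiguity in lifting a covector. So it factors through the finite-dimensional `W°`, where ranks can
be counted. -/
theorem exists_range_eq (hA : Represents s J W A) (hs : IsSkew s) (hJ : Function.Injective J) :
    ∃ f : W.dualAnnihilator →ₗ[ℝ] H, LinearMap.range f = LinearMap.range A.toLinearMap ∧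
      (LinearMap.ker f).map W.dualAnnihilator.subtype = conormalKernel s W := by
  obtain ⟨γ, hγ⟩ := (pullbackInner J).exists_rightInverse_of_surjective
    (LinearMap.range_eq_top.2 (pullbackInner_surjective hJ))
  have hγ' (ξ : Module.Dual ℝ V) : pullbackInner J (γ ξ) = ξ := LinearMap.congr_fun hγ ξ
  let f : W.dualAnnihilator →ₗ[ℝ] H := A.toLinearMap ∘ₗ γ ∘ₗ W.dualAnnihilator.subtype
  refine ⟨f, ?_, ?_⟩
  · apply le_antisymm
    · rintro _ ⟨ξ, rfl⟩
      exact ⟨γ ξ, rfl⟩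
    · rintro _ ⟨h, rfl⟩
      obtain ⟨h', hh', he⟩ := hA.exists_orthogonal h
      refine ⟨⟨pullbackInner J h', pullbackInner_mem_dualAnnihilator.2 hh'⟩, ?_⟩
      change A (γ (pullbackInner J h')) = A h
      rw [← he, ← sub_eq_zero, ← map_sub]
      have h0 : pullbackInner J (γ (pullbackInner J h') - h') = 0 := by
        rw [map_sub, hγ', sub_self]
      rw [hA.apply_eq_zero_iff hs hJ, h0]
      · exact Submodule.zero_mem _
      · rw [← pullbackInner_mem_dualAnnihilator, h0]
        exact Submodule.zero_mem _
  · have hiff (ξ : Module.Dual ℝ V) (hξ : ξ ∈ W.dualAnnihilator) :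
        A (γ ξ) = 0 ↔ ξ ∈ conormalKernel s W := by
      rw [hA.apply_eq_zero_iff hs hJ, hγ']
      rwa [← pullbackInner_mem_dualAnnihilator, hγ']
    ext ξ
    constructor
    · rintro ⟨ξ, h0, rfl⟩
      exact (hiff ξ ξ.2).1 h0
    · intro hξ
      exact ⟨⟨ξ, hξ.1⟩, (hiff ξ hξ.1).2 hξ, rfl⟩

theorem finiteDimensional_range (hA : Represents s J W A) (hs : IsSkew s)
    (hJ : Function.Injective J) : FiniteDimensional ℝ (LinearMap.range A.toLinearMap) := by
  obtain ⟨f, hf, -⟩ := hA.exists_range_eq hs hJ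
  rw [← hf]
  infer_instance

theorem finrank_range_add (hA : Represents s J W A) (hs : IsSkew s) (hJ : Function.Injective J) :
    Module.finrank ℝ (LinearMap.range A.toLinearMap) + Module.finrank ℝ (conormalKernel s W) =
      Module.finrank ℝ W.dualAnnihilator := by
  obtain ⟨f, hrange, hker⟩ := hA.exists_range_eq hs hJ
  have h1 : Module.finrank ℝ (conormalKernel s W) = Module.finrank ℝ (LinearMap.ker f) :=
    hker ▸ Submodule.finrank_map_subtype_eq W.dualAnnihilator (LinearMap.ker f)
  have h2 := LinearMap.finrank_range_add_finrank_ker (K := ℝ) (V := W.dualAnnihilator) f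
  have h3 := congrArg (fun X : Submodule ℝ H ↦ Module.finrank ℝ X) hrange
  lia

theorem finrank_range (hA : Represents s J W A) (hs : IsSkew s) (hJ : Function.Injective J) :
    Module.finrank ℝ (LinearMap.range A.toLinearMap) + Module.finrank ℝ W =
      Module.finrank ℝ ↥(W ⊔ sharpAnn s W) := by
  have h1 := hA.finrank_range_add hs hJ
  have h2 := finrank_conormalKernel s W
  have h3 := Subspace.finrank_add_finrank_dualAnnihilator_eq W
  lia

theorem dualAnnihilator_eq (hT : ∀ v, v ∈ T ↔ ∀ h, inner ℝ (A h) (J v) = 0) :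
    T.dualAnnihilator = (LinearMap.range A.toLinearMap).map (pullbackInner J) := by
  have h := Subspace.dualCoannihilator_dualAnnihilator_eq
    (W := (LinearMap.range A.toLinearMap).map (pullbackInner J))
  refine Eq.trans ?_ h
  congr 1
  ext v
  rw [hT, Submodule.mem_dualCoannihilator]
  simp

theorem inf_eq_bot (hA : Represents s J W A) (hs : IsSkew s) (hJ : Function.Injective J)
    (hT : ∀ v, v ∈ T ↔ ∀ h, inner ℝ (A h) (J v) = 0) :
    T.dualAnnihilator ⊓ conormalKernel s W = ⊥ := by
  rw [eq_bot_iff, dualAnnihilator_eq hT]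
  rintro _ ⟨⟨h, hh, rfl⟩, hK⟩
  rw [hA.eq_zero_of_mem hs hJ hh hK, map_zero]
  exact Submodule.zero_mem _

/-- A dimension count: pullback is injective on the range of `A`, so `T°` has the dimension of that
range, and rank plus nullity is `dim W°`. -/
theorem sup_eq (hA : Represents s J W A) (hs : IsSkew s) (hJ : Function.Injective J)
    (hT : ∀ v, v ∈ T ↔ ∀ h, inner ℝ (A h) (J v) = 0) :
    T.dualAnnihilator ⊔ conormalKernel s W = W.dualAnnihilator := by
  have hle : T.dualAnnihilator ⊔ conormalKernel s W ≤ W.dualAnnihilator := by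
    refine sup_le ?_ inf_le_left
    rw [dualAnnihilator_eq hT]
    rintro _ ⟨_, ⟨h, rfl⟩, rfl⟩
    exact pullbackInner_mem_dualAnnihilator.2 (hA.apply_mem h)
  refine Submodule.eq_of_le_of_finrank_eq hle ?_
  have h1 := Submodule.finrank_sup_add_finrank_inf_eq T.dualAnnihilator (conormalKernel s W)
  rw [hA.inf_eq_bot hs hJ hT, finrank_bot, add_zero] at h1
  have hinj : Module.finrank ℝ T.dualAnnihilator =
      Module.finrank ℝ (LinearMap.range A.toLinearMap) := by
    rw [dualAnnihilator_eq hT]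
    let g : LinearMap.range A.toLinearMap →ₗ[ℝ] Module.Dual ℝ V :=
      pullbackInner J ∘ₗ (LinearMap.range A.toLinearMap).subtype
    have hg : Function.Injective g := by
      refine (injective_iff_map_eq_zero _).2 fun h h0 ↦ ?_
      have h0' : pullbackInner J (h : H) = 0 := h0
      refine Subtype.ext (hA.eq_zero_of_mem hs hJ h.2 ?_)
      rw [h0']
      exact Submodule.zero_mem _
    rw [← LinearMap.finrank_range_of_inj hg, LinearMap.range_comp, Submodule.range_subtype]
  rw [h1, hinj, hA.finrank_range_add hs hJ]

end Represents

end Hilbert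

end PoissonLinear

end

noncomputable section

open Filter Topology

/-! ### Smooth correction of near-idempotents. -/

section BanachAlgebra

variable (A : Type*) [NormedRing A] [NormedAlgebra ℝ A] [CompleteSpace A]

/-- Squaring has a smooth local inverse at `1`. -/
theorem exists_local_sqrt : ∃ ψ : A → A, ψ 1 = 1 ∧ (∀ᶠ y in 𝓝 (1 : A), ψ y * ψ y = y) ∧
    (∀ᶠ z in 𝓝 (1 : A), ψ (z * z) = z) ∧ ∀ᶠ y in 𝓝 (1 : A), ContDiffAt ℝ ∞ ψ y := by
  let D : A ≃L[ℝ] A := ContinuousLinearEquiv.equivOfInverse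
    ((2 : ℝ) • ContinuousLinearMap.id ℝ A) ((2⁻¹ : ℝ) • ContinuousLinearMap.id ℝ A)
    (fun x ↦ by simp) (fun x ↦ by simp)
  have hf : ContDiffAt ℝ ω (fun z : A ↦ z * z) 1 := (contDiff_id.mul contDiff_id).contDiffAt
  have hf' : HasFDerivAt (fun z : A ↦ z * z) (D : A →L[ℝ] A) 1 := by
    refine ((hasFDerivAt_id (𝕜 := ℝ) (1 : A)).mul' (hasFDerivAt_id (1 : A))).congr_fderiv ?_
    ext x
    simp [D, two_smul]
  have hω : (ω : WithTop ℕ∞) ≠ 0 := by simp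
  have hs := hf.hasStrictFDerivAt' hf' hω
  refine ⟨hf.localInverse hf' hω, ?_, ?_, ?_, ?_⟩
  · simpa using hf.localInverse_apply_image hf' hω
  · have h := hs.eventually_right_inverse
    rwa [mul_one] at h
  · exact hs.eventually_left_inverse
  · have h := (hf.to_localInverse hf' hω).eventually (by simp)
    rw [mul_one] at h
    exact h.mono fun y hy ↦ hy.of_le le_top

/-- There is a map of a Banach algebra to itself that fixes the idempotents and, near each of
them, is smooth with idempotent values. -/
theorem exists_idempotent_correction : ∃ σ : A → A, ∀ e : A, IsIdempotentElem e →
    σ e = e ∧ ∀ᶠ a in 𝓝 e, IsIdempotentElem (σ a) ∧ ContDiffAt ℝ ∞ σ a := by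
  obtain ⟨ψ, hψ1, hψr, hψl, hψs⟩ := exists_local_sqrt A
  -- Idempotents `a` correspond to involutions `2a - 1`. The correction replaces `N` by its
  -- normalization `N (N²)^(-1/2)`, with the square root taken near `1`.
  let N : A → A := fun a ↦ (2 : ℝ) • a - 1
  let Y : A → A := fun a ↦ Ring.inverse (N a * N a)
  let Z : A → A := fun a ↦ ψ (Y a)
  refine ⟨fun a ↦ (2⁻¹ : ℝ) • (1 + N a * Z a), fun e he ↦ ?_⟩
  have hNe : N e * N e = 1 := by
    have he' : e * e = e := he
    simp only [N, sub_mul, mul_sub, he', one_mul, mul_one, smul_mul_assoc,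
      mul_smul_comm]
    module
  have hYe : Y e = 1 := by simp [Y, hNe]
  have hZe : Z e = 1 := by simp [Z, hYe, hψ1]
  have hNs (a : A) : ContDiffAt ℝ ∞ N a := by fun_prop
  have hunit : IsUnit (N e * N e) := hNe ▸ isUnit_one
  have hNunit : IsUnit (N e) := ⟨⟨N e, N e, hNe, hNe⟩, rfl⟩
  have hYs {a : A} (ha : IsUnit (N a * N a)) : ContDiffAt ℝ ∞ Y a := by
    obtain ⟨u, hu⟩ := ha
    have h := contDiffAt_ringInverse ℝ (n := ∞) u
    rw [hu] at h
    exact h.comp a ((hNs a).mul (hNs a))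
  have hNc : ContinuousAt N e := (hNs e).continuousAt
  have hYc : Tendsto Y (𝓝 e) (𝓝 1) := hYe ▸ (hYs hunit).continuousAt.tendsto
  have hψc : ContinuousAt ψ 1 := hψs.self_of_nhds.continuousAt
  have hZc : Tendsto Z (𝓝 e) (𝓝 1) := by
    have := hψc.tendsto.comp hYc
    rwa [hψ1] at this
  have hinv : ContinuousAt (fun a ↦ Ring.inverse (N a)) e := by
    obtain ⟨u, hu⟩ := hNunit
    have h := NormedRing.inverse_continuousAt u
    rw [hu] at h
    exact h.comp hNc
  -- `Z a` must commute with `N a`. The conjugate of `Z a` by `N a` is another square root of `Y a`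
  -- close to `1`, so local uniqueness of square roots identifies the two.
  have hconj : Tendsto (fun a ↦ N a * Z a * Ring.inverse (N a)) (𝓝 e) (𝓝 1) := by
    have h := (hNc.tendsto.mul hZc).mul hinv.tendsto
    rwa [mul_one, Ring.mul_inverse_cancel _ hNunit] at h
  refine ⟨by simp [hZe, N], ?_⟩
  filter_upwards [hYc.eventually hψr, hYc.eventually hψs, hconj.eventually hψl,
    hNc.eventually (Units.isOpen.mem_nhds hNunit)] with a h1 h2 h3 h4
  have h4' : IsUnit (N a) := h4
  have h5 : IsUnit (N a * N a) := h4'.mul h4'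
  have hYN : Y a * (N a * N a) = 1 := Ring.inverse_mul_cancel _ h5
  have hNY : N a * N a * Y a = 1 := Ring.mul_inverse_cancel _ h5
  have hcomm : N a * Y a = Y a * N a :=
    calc N a * Y a = Y a * (N a * N a) * (N a * Y a) := by rw [hYN, one_mul]
      _ = Y a * N a * (N a * N a * Y a) := by noncomm_ring
      _ = Y a * N a := by rw [hNY, mul_one]
  have hinvN : Ring.inverse (N a) * N a = 1 := Ring.inverse_mul_cancel _ h4'
  have hNinv : N a * Ring.inverse (N a) = 1 := Ring.mul_inverse_cancel _ h4'
  have hsq : N a * Z a * Ring.inverse (N a) * (N a * Z a * Ring.inverse (N a)) = Y a :=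
    calc _ = N a * Z a * (Ring.inverse (N a) * N a) * Z a * Ring.inverse (N a) := by noncomm_ring
      _ = N a * (Z a * Z a) * Ring.inverse (N a) := by rw [hinvN]; noncomm_ring
      _ = Y a * (N a * Ring.inverse (N a)) := by rw [h1, hcomm, mul_assoc]
      _ = Y a := by rw [hNinv, mul_one]
  rw [hsq] at h3
  have hZN : Z a * N a = N a * Z a := by
    calc Z a * N a = N a * Z a * Ring.inverse (N a) * N a := by rw [← h3]
      _ = N a * Z a := by rw [mul_assoc, hinvN, mul_one]
  have hinvol : N a * Z a * (N a * Z a) = 1 :=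
    calc _ = N a * (Z a * N a) * Z a := by noncomm_ring
      _ = N a * N a * (Z a * Z a) := by rw [hZN]; noncomm_ring
      _ = 1 := by rw [h1, hNY]
  refine ⟨?_, ?_⟩
  · change (2⁻¹ : ℝ) • (1 + N a * Z a) * (2⁻¹ : ℝ) • (1 + N a * Z a) = _
    rw [smul_mul_smul_comm, add_mul, mul_add, mul_add, hinvol]
    simp only [one_mul, mul_one]
    module
  · have : ContDiffAt ℝ ∞ Z a := h2.comp a (hYs h5)
    exact (contDiffAt_const.add ((hNs a).mul this)).const_smul _

end BanachAlgebra

/-! ### Formula and smoothness for projections to ranges of injective operators. -/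

section Projection

variable {G H : Type*} [NormedAddCommGroup G] [InnerProductSpace ℝ G] [FiniteDimensional ℝ G]
  [NormedAddCommGroup H] [InnerProductSpace ℝ H] [CompleteSpace H]

theorem isUnit_adjoint_comp_self {L : G →L[ℝ] H} (hL : Function.Injective L) :
    IsUnit (L.adjoint ∘L L) := by
  have hinj : Function.Injective (L.adjoint ∘L L) := by
    refine (injective_iff_map_eq_zero _).2 fun x hx ↦ ?_
    have h : inner ℝ ((L.adjoint ∘L L) x) x = 0 := by rw [hx, inner_zero_left]
    rw [ContinuousLinearMap.comp_apply, ContinuousLinearMap.adjoint_inner_left,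
      inner_self_eq_zero] at h
    exact hL (by rw [h, map_zero])
  rw [ContinuousLinearMap.isUnit_iff_bijective]
  exact ⟨hinj, LinearMap.injective_iff_surjective.1 hinj⟩

/-- The orthogonal projection to the range of an injective operator `L` is `L (L* L)⁻¹ L*`. -/
theorem starProjection_range_eq {L : G →L[ℝ] H} (hL : Function.Injective L) :
    (LinearMap.range L.toLinearMap).starProjection =
      L ∘L Ring.inverse (L.adjoint ∘L L) ∘L L.adjoint := by
  ext h
  refine Submodule.eq_starProjection_of_mem_orthogonal
    (v := (L ∘L Ring.inverse (L.adjoint ∘L L) ∘L L.adjoint) h) ⟨_, rfl⟩ ?_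
  rw [Submodule.mem_orthogonal]
  rintro _ ⟨x, rfl⟩
  have hc := Ring.mul_inverse_cancel _ (isUnit_adjoint_comp_self hL)
  have hc' := DFunLike.congr_fun hc (L.adjoint h)
  simp only [ContinuousLinearMap.mul_def, ContinuousLinearMap.comp_apply,
    one_apply_eq_self] at hc'
  change inner ℝ (L x) _ = 0
  rw [← ContinuousLinearMap.adjoint_inner_right, map_sub]
  simp [hc']

theorem contDiffAt_starProjection_range {L : G →L[ℝ] H} (hL : Function.Injective L) :
    ContDiffAt ℝ ∞ (fun L : G →L[ℝ] H ↦ L ∘L Ring.inverse (L.adjoint ∘L L) ∘L L.adjoint) L := by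
  have hadj : ContDiff ℝ ∞ (fun L : G →L[ℝ] H ↦ L.adjoint) :=
    (ContinuousLinearMap.adjoint (𝕜 := ℝ) (E := G) (F := H)).toContinuousLinearEquiv.contDiff
  obtain ⟨u, hu⟩ := isUnit_adjoint_comp_self hL
  have h := contDiffAt_ringInverse ℝ (n := ∞) u
  rw [hu] at h
  have hinv : ContDiffAt ℝ ∞ (fun L : G →L[ℝ] H ↦ Ring.inverse (L.adjoint ∘L L)) L :=
    ContDiffAt.comp (f := fun L : G →L[ℝ] H ↦ L.adjoint ∘L L) L h
      (hadj.clm_comp contDiff_id).contDiffAt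
  exact contDiffAt_id.clm_comp (hinv.clm_comp hadj.contDiffAt)

end Projection

end

/-! ### Inverse functions, derivatives in charts and regular level sets. -/

noncomputable section

open Filter Topology

/-- The inverse function theorem, with a smooth local inverse. -/
theorem exists_openPartialHomeomorph_contDiffOn {E : Type*} [NormedAddCommGroup E]
    [NormedSpace ℝ E] [CompleteSpace E] {θ : E → E} {x₀ : E}
    (hθ : ∀ᶠ x in 𝓝 x₀, ContDiffAt ℝ ∞ θ x)
    (hθ' : HasFDerivAt θ (ContinuousLinearMap.id ℝ E) x₀) {s : Set E} (hs : s ∈ 𝓝 x₀) :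
    ∃ e : OpenPartialHomeomorph E E, (e : E → E) = θ ∧ x₀ ∈ e.source ∧ e.source ⊆ s ∧
      ContDiffOn ℝ ∞ e e.source ∧ ContDiffOn ℝ ∞ e.symm e.target := by
  have hne : (∞ : WithTop ℕ∞) ≠ 0 := by simp
  have h0 := hθ.self_of_nhds
  have hθ'' : HasFDerivAt θ ((ContinuousLinearEquiv.refl ℝ E : E ≃L[ℝ] E) : E →L[ℝ] E) x₀ := hθ'
  let e := h0.toOpenPartialHomeomorph θ hθ'' hne
  have hcont : ContinuousAt (fderiv ℝ θ) x₀ :=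
    (h0.fderiv_right (m := 0) (by simp)).continuousAt
  have hunit : ∀ᶠ x in 𝓝 x₀, IsUnit (fderiv ℝ θ x) := by
    refine hcont.eventually (Units.isOpen.mem_nhds ?_)
    rw [hθ'.fderiv]
    exact isUnit_one
  -- Restricting to points with invertible derivative makes the inverse smooth on the whole target,
  -- as a chart requires.
  obtain ⟨O, hO, hOo, hxO⟩ := eventually_nhds_iff.1 ((hθ.and hunit).and hs)
  have hsrc {x : E} (hx : x ∈ (e.restr O).source) : x ∈ O := by
    rw [e.restr_source' O hOo] at hx
    exact hx.2
  refine ⟨e.restr O, rfl, ?_, fun x hx ↦ (hO x (hsrc hx)).2, ?_, ?_⟩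
  · rw [e.restr_source' O hOo]
    exact ⟨h0.mem_toOpenPartialHomeomorph_source hθ'' hne, hxO⟩
  · exact fun x hx ↦ (hO x (hsrc hx)).1.1.contDiffWithinAt
  · intro y hy
    have hx := hsrc ((e.restr O).map_target hy)
    obtain ⟨u, hu⟩ := (hO _ hx).1.2
    refine ((e.restr O).contDiffAt_symm (f₀' := ContinuousLinearEquiv.unitsEquiv ℝ E u) hy ?_
      (hO _ hx).1.1).contDiffWithinAt
    have hd : HasFDerivAt θ (fderiv ℝ θ ((e.restr O).symm y)) ((e.restr O).symm y) :=
      ((hO _ hx).1.1.differentiableAt hne).hasFDerivAt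
    rw [← hu] at hd
    exact hd

variable {E : Type*} [NormedAddCommGroup E] [NormedSpace ℝ E]
  {P : Type*} [TopologicalSpace P] [ChartedSpace E P]

theorem differentiableAt_comp_symm {X : Type*} [NormedAddCommGroup X] [NormedSpace ℝ X]
    {f : P → X} {p : P} {φ : OpenPartialHomeomorph P E}
    (hφ : φ ∈ IsManifold.maximalAtlas 𝓘(ℝ, E) ∞ P) (hp : p ∈ φ.source)
    (hf : MDifferentiableAt 𝓘(ℝ, E) 𝓘(ℝ, X) f p) : DifferentiableAt ℝ (f ∘ φ.symm) (φ p) := by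
  have hf' : MDifferentiableAt 𝓘(ℝ, E) 𝓘(ℝ, X) f (φ.symm (φ p)) := by rwa [φ.left_inv hp]
  exact mdifferentiableAt_iff_differentiableAt.1 (hf'.comp (φ p)
    ((contMDiffAt_symm_of_mem_maximalAtlas hφ (φ.map_source hp)).mdifferentiableAt (by simp)))

/-- The derivative of a vector-valued function, computed in a chart. -/
theorem mvfderiv_eq_fderiv_comp {X : Type*} [NormedAddCommGroup X] [NormedSpace ℝ X] {f : P → X}
    {p : P} {φ : OpenPartialHomeomorph P E} (hφ : φ ∈ IsManifold.maximalAtlas 𝓘(ℝ, E) ∞ P)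
    (hp : p ∈ φ.source) (hf : MDifferentiableAt 𝓘(ℝ, E) 𝓘(ℝ, X) f p) :
    mvfderiv 𝓘(ℝ, E) f p =
      (fderiv ℝ (f ∘ φ.symm) (φ p)).comp (mvfderiv 𝓘(ℝ, E) φ p) := by
  have hne : (∞ : WithTop ℕ∞) ≠ 0 := by simp
  have hd : MDifferentiableAt 𝓘(ℝ, E) 𝓘(ℝ, X) (f ∘ φ.symm) (φ p) :=
    (differentiableAt_comp_symm hφ hp hf).mdifferentiableAt
  have h1 := mfderiv_comp (I := 𝓘(ℝ, E)) (I' := 𝓘(ℝ, E)) (I'' := 𝓘(ℝ, X)) p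
    hd ((contMDiffAt_of_mem_maximalAtlas hφ hp).mdifferentiableAt hne)
  have h2 : (f ∘ φ.symm) ∘ φ =ᶠ[𝓝 p] f := by
    filter_upwards [φ.open_source.mem_nhds hp] with q hq
    simp [φ.left_inv hq]
  rw [h2.mfderiv_eq, mfderiv_eq_fderiv] at h1
  ext v
  change mfderiv 𝓘(ℝ, E) 𝓘(ℝ, X) f p v = _
  rw [h1]
  rfl

/-- The regular value theorem: a level set of a submersion has slice charts. -/
theorem exists_isSliceChart_of_submersion [IsManifold 𝓘(ℝ, E) ∞ P] {Y : Type*} [NormedAddCommGroup Y]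
    [NormedSpace ℝ Y] [FiniteDimensional ℝ E] [FiniteDimensional ℝ Y] {S : Set P} {p : P} {G : P → Y}
    (hG : ∀ᶠ q in 𝓝 p, ContMDiffAt 𝓘(ℝ, E) 𝓘(ℝ, Y) ∞ G q)
    (hS : ∀ᶠ q in 𝓝 p, (q ∈ S ↔ G q = 0))
    (hsurj : Function.Surjective (mvfderiv 𝓘(ℝ, E) G p)) :
    ∃ (φ : OpenPartialHomeomorph P E) (F : Submodule ℝ E), IsSliceChart S p φ F ∧
      Module.finrank ℝ F + Module.finrank ℝ Y = Module.finrank ℝ E ∧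
      ∀ v, mfderiv 𝓘(ℝ, E) 𝓘(ℝ, E) φ p v ∈ F ↔ mvfderiv 𝓘(ℝ, E) G p v = 0 := by
  have hne : (∞ : WithTop ℕ∞) ≠ 0 := by simp
  let χ := chartAt E p
  have hχ : χ ∈ IsManifold.maximalAtlas 𝓘(ℝ, E) ∞ P := IsManifold.chart_mem_maximalAtlas p
  have hpχ : p ∈ χ.source := mem_chart_source E p
  have hxχ : χ p ∈ χ.target := χ.map_source hpχ
  have hsymm : χ.symm (χ p) = p := χ.left_inv hpχ
  have hχm : ContMDiffAt 𝓘(ℝ, E) 𝓘(ℝ, E) ∞ χ p := contMDiffAt_of_mem_maximalAtlas hχ hpχ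
  have hχsm {x : E} (hx : x ∈ χ.target) : ContMDiffAt 𝓘(ℝ, E) 𝓘(ℝ, E) ∞ χ.symm x :=
    contMDiffAt_symm_of_mem_maximalAtlas hχ hx
  have htend : Tendsto χ.symm (𝓝 (χ p)) (𝓝 p) := by
    simpa only [hsymm] using (χ.continuousAt_symm hxχ).tendsto
  let g : E → Y := G ∘ χ.symm
  have hg : ∀ᶠ x in 𝓝 (χ p), ContDiffAt ℝ ∞ g x := by
    filter_upwards [htend.eventually hG, χ.open_target.mem_nhds hxχ] with x hx hxt
    exact (hx.comp x (hχsm hxt)).contDiffAt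
  have hGm : MDifferentiableAt 𝓘(ℝ, E) 𝓘(ℝ, Y) G p := hG.self_of_nhds.mdifferentiableAt hne
  have hgd : DifferentiableAt ℝ g (χ p) := hg.self_of_nhds.differentiableAt hne
  set D : E →L[ℝ] Y := fderiv ℝ g (χ p) with hD
  have hDG (v : TangentSpace 𝓘(ℝ, E) p) :
      D (mfderiv 𝓘(ℝ, E) 𝓘(ℝ, E) χ p v) = mvfderiv 𝓘(ℝ, E) G p v := by
    rw [mvfderiv_eq_fderiv_comp hχ hpχ hGm]
    rfl
  have hDsurj : Function.Surjective D := fun y ↦ by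
    obtain ⟨v, hv⟩ := hsurj y
    exact ⟨_, (hDG v).trans hv⟩
  obtain ⟨s, hs⟩ := D.toLinearMap.exists_rightInverse_of_surjective
    (LinearMap.range_eq_top.2 hDsurj)
  let sL : Y →L[ℝ] E := s.toContinuousLinearMap
  have hsD (y : Y) : D (sL y) = y := LinearMap.congr_fun hs y
  -- Straightens `g`: `D ∘ θ = g`, so zeros of `g` go to `ker D`, while the derivative of `θ` at the
  -- base point is the identity.
  let θ : E → E := fun x ↦ x - sL (D x) + sL (g x)
  have hDθ (x : E) : D (θ x) = g x := by
    simp only [θ, map_add, map_sub, hsD, sub_self, zero_add]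
  have hθ : ∀ᶠ x in 𝓝 (χ p), ContDiffAt ℝ ∞ θ x := by
    filter_upwards [hg] with x hx
    exact (contDiffAt_id.sub (sL.contDiff.comp D.contDiff).contDiffAt).add
      (sL.contDiff.contDiffAt.comp x hx)
  have hθ' : HasFDerivAt θ (ContinuousLinearMap.id ℝ E) (χ p) := by
    have h1 := ((hasFDerivAt_id (𝕜 := ℝ) (χ p)).sub (sL.comp D).hasFDerivAt).add
      (sL.hasFDerivAt.comp (χ p) hgd.hasFDerivAt)
    refine h1.congr_fderiv ?_
    rw [← hD]
    abel
  obtain ⟨e, heθ, hpe, hes, hes1, hes2⟩ := exists_openPartialHomeomorph_contDiffOn hθ hθ'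
    (htend.eventually hS)
  have hφcoe : ((χ.trans e : OpenPartialHomeomorph P E) : P → E) = θ ∘ χ := by
    rw [← heθ]
    rfl
  refine ⟨χ.trans e, LinearMap.ker D.toLinearMap, ⟨?_, ?_, ?_⟩, ?_, ?_⟩
  · refine OpenPartialHomeomorph.mem_maximalAtlas_of_contMDiffOn _ ?_ ?_
    · rw [OpenPartialHomeomorph.coe_trans, OpenPartialHomeomorph.trans_source]
      exact hes1.contMDiffOn.comp ((contMDiffOn_of_mem_maximalAtlas hχ).mono
        Set.inter_subset_left) Set.inter_subset_right
    · rw [OpenPartialHomeomorph.coe_trans_symm, OpenPartialHomeomorph.trans_target]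
      exact (contMDiffOn_symm_of_mem_maximalAtlas hχ).comp (hes2.contMDiffOn.mono
        Set.inter_subset_left) Set.inter_subset_right
  · rw [OpenPartialHomeomorph.trans_source]
    exact ⟨hpχ, hpe⟩
  · intro q hq
    rw [OpenPartialHomeomorph.trans_source] at hq
    have h1 : χ.symm (χ q) ∈ S ↔ G (χ.symm (χ q)) = 0 := hes hq.2
    rw [χ.left_inv hq.1] at h1
    rw [h1, hφcoe, LinearMap.mem_ker]
    change _ ↔ D (θ (χ q)) = 0
    rw [hDθ]
    change _ ↔ G (χ.symm (χ q)) = 0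
    rw [χ.left_inv hq.1]
  · have h1 := D.toLinearMap.finrank_range_add_finrank_ker
    rw [LinearMap.range_eq_top.2 hDsurj, finrank_top] at h1
    lia
  · intro v
    have h1 := mfderiv_comp (I := 𝓘(ℝ, E)) (I' := 𝓘(ℝ, E)) (I'' := 𝓘(ℝ, E)) p
      hθ'.differentiableAt.mdifferentiableAt (hχm.mdifferentiableAt hne)
    rw [hφcoe, h1, mfderiv_eq_fderiv, hθ'.fderiv, ← hDG]
    rfl

end

/-! ### Partitions of unity on an open union, and gluing. -/

noncomputable section

open Filter Topology

variable {E : Type*} [NormedAddCommGroup E] [NormedSpace ℝ E]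
  {P : Type*} [TopologicalSpace P] [ChartedSpace E P] {ι : Type*}

variable (E) in
/-- The functions `ρ i` form a smooth locally finite partition of unity on the union of the open
sets `U i`, subordinate to `U`. -/
structure IsOpenPartition (U : ι → Set P) (ρ : ι → P → ℝ) : Prop where
  contMDiffAt : ∀ i, ∀ p ∈ ⋃ i, U i, ContMDiffAt 𝓘(ℝ, E) 𝓘(ℝ, ℝ) ∞ (ρ i) p
  exists_finset : ∀ p ∈ ⋃ i, U i, ∃ s : Finset ι, (∀ i ∈ s, p ∈ U i) ∧
    (∀ᶠ q in 𝓝 p, ∀ i ∉ s, ρ i q = 0) ∧ ∑ i ∈ s, ρ i p = 1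

theorem exists_isOpenPartition [FiniteDimensional ℝ E] [T2Space P] [SecondCountableTopology P]
    [IsManifold 𝓘(ℝ, E) ∞ P] (U : ι → Set P) (hU : ∀ i, IsOpen (U i)) :
    ∃ ρ : ι → P → ℝ, IsOpenPartition E U ρ := by
  classical
  let O : TopologicalSpace.Opens P := ⟨⋃ i, U i, isOpen_iUnion hU⟩
  have : LocallyCompactSpace P := ChartedSpace.locallyCompactSpace E P
  have : LocallyCompactSpace O := O.isOpen.locallyCompactSpace
  obtain ⟨f, hf⟩ := SmoothPartitionOfUnity.exists_isSubordinate 𝓘(ℝ, E) (M := O)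
    (s := Set.univ) isClosed_univ (fun i ↦ Subtype.val ⁻¹' U i)
    (fun i ↦ (hU i).preimage continuous_subtype_val) (fun x _ ↦ by
      obtain ⟨i, hi⟩ := Set.mem_iUnion.1 x.2
      exact Set.mem_iUnion.2 ⟨i, hi⟩)
  -- The partition lives on the open submanifold `O`. Its extension by zero need not be smooth at
  -- the boundary of `O`, and smoothness is only claimed on `O`.
  let ρ : ι → P → ℝ := fun i p ↦ if h : p ∈ O then f i ⟨p, h⟩ else 0
  have hρ (i : ι) (x : O) : ρ i x = f i x := by simp [ρ]
  refine ⟨ρ, fun i p hp ↦ ?_, fun p hp ↦ ?_⟩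
  · have h : ContMDiffAt 𝓘(ℝ, E) 𝓘(ℝ, ℝ) ∞ (fun x : O ↦ ρ i x) ⟨p, hp⟩ := by
      simp only [hρ]
      exact (f i).contMDiff.contMDiffAt
    exact contMDiffAt_subtype_iff.1 h
  · refine ⟨f.fintsupport ⟨p, hp⟩, fun i hi ↦ hf i ((f.mem_fintsupport_iff _ i).1 hi), ?_, ?_⟩
    · have h := f.eventually_finsupport_subset ⟨p, hp⟩
      have h' : ∀ᶠ x : O in 𝓝 ⟨p, hp⟩, ∀ i ∉ f.fintsupport ⟨p, hp⟩, ρ i x = 0 := by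
        filter_upwards [h] with x hx i hi
        by_contra h0
        rw [hρ] at h0
        exact hi (hx ((f.mem_finsupport x).2 h0))
      rw [← O.isOpenEmbedding'.map_nhds_eq ⟨p, hp⟩, eventually_map]
      exact h'
    · rw [← f.sum_finsupport' ⟨p, hp⟩ (Set.mem_univ _) (f.finsupport_subset_fintsupport ⟨p, hp⟩)]
      exact Finset.sum_congr rfl fun i _ ↦ hρ i ⟨p, hp⟩

/-- The sum of local functions `g i` with weights `ρ i`. -/
def glue {X : Type*} [NormedAddCommGroup X] [NormedSpace ℝ X] (ρ : ι → P → ℝ) (g : ι → P → X)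
    (q : P) : X :=
  ∑ᶠ i, ρ i q • g i q

namespace IsOpenPartition

variable {X : Type*} [NormedAddCommGroup X] [NormedSpace ℝ X] {U : ι → Set P} {ρ : ι → P → ℝ}
  {p : P} {g : ι → P → X}

theorem exists_glue_eq (h : IsOpenPartition E U ρ) (hp : p ∈ ⋃ i, U i) (g : ι → P → X) :
    ∃ s : Finset ι, (∀ i ∈ s, p ∈ U i) ∧ ∑ i ∈ s, ρ i p = 1 ∧
      glue ρ g =ᶠ[𝓝 p] fun q ↦ ∑ i ∈ s, ρ i q • g i q := by
  obtain ⟨s, h1, h2, h3⟩ := h.exists_finset p hp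
  refine ⟨s, h1, h3, ?_⟩
  filter_upwards [h2] with q hq
  refine finsum_eq_sum_of_support_subset _ fun i hi ↦ ?_
  by_contra his
  exact hi (by simp [hq i his])

theorem glue_apply (h : IsOpenPartition E U ρ) (hp : p ∈ ⋃ i, U i) {a : X}
    (hg : ∀ i, p ∈ U i → g i p = a) : glue ρ g p = a := by
  obtain ⟨s, h1, h2, h3⟩ := h.exists_glue_eq hp g
  rw [h3.eq_of_nhds, Finset.sum_congr rfl fun i hi ↦ by rw [hg i (h1 i hi)],
    ← Finset.sum_smul, h2, one_smul]

theorem contMDiffAt_glue (h : IsOpenPartition E U ρ) (hp : p ∈ ⋃ i, U i)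
    (hg : ∀ i, p ∈ U i → ContMDiffAt 𝓘(ℝ, E) 𝓘(ℝ, X) ∞ (g i) p) :
    ContMDiffAt 𝓘(ℝ, E) 𝓘(ℝ, X) ∞ (glue ρ g) p := by
  obtain ⟨s, h1, h2, h3⟩ := h.exists_glue_eq hp g
  refine ContMDiffAt.congr_of_eventuallyEq ?_ h3
  exact contMDiffAt_finsetSum fun i hi ↦ (h.contMDiffAt i p hp).smul (hg i (h1 i hi))

/-- At a point where the functions `g i` vanish, the derivative of the glued function is the
weighted mean of the derivatives of the functions `g i`. -/
theorem apply_mvfderiv_glue [IsManifold 𝓘(ℝ, E) ∞ P] (h : IsOpenPartition E U ρ)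
    (hp : p ∈ ⋃ i, U i)
    (hg : ∀ i, p ∈ U i → ContMDiffAt 𝓘(ℝ, E) 𝓘(ℝ, X) ∞ (g i) p)
    (hg0 : ∀ i, p ∈ U i → g i p = 0) {Y : Type*} [NormedAddCommGroup Y] [NormedSpace ℝ Y]
    (ℓ : X →L[ℝ] Y) {v : TangentSpace 𝓘(ℝ, E) p} {y : Y}
    (hv : ∀ i, p ∈ U i → ℓ (mvfderiv 𝓘(ℝ, E) (g i) p v) = y) :
    ℓ (mvfderiv 𝓘(ℝ, E) (glue ρ g) p v) = y := by
  have hne : (∞ : WithTop ℕ∞) ≠ 0 := by simp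
  obtain ⟨s, h1, h2, h3⟩ := h.exists_glue_eq hp g
  have hd (i : ι) : MDifferentiableAt 𝓘(ℝ, E) 𝓘(ℝ, ℝ) (ρ i) p := (h.contMDiffAt i p hp).mdifferentiableAt hne
  have hgd (i : ι) (hi : i ∈ s) : MDifferentiableAt 𝓘(ℝ, E) 𝓘(ℝ, X) (g i) p :=
    (hg i (h1 i hi)).mdifferentiableAt hne
  let χ := chartAt E p
  have hχ : χ ∈ IsManifold.maximalAtlas 𝓘(ℝ, E) ∞ P := IsManifold.chart_mem_maximalAtlas p
  have hpχ : p ∈ χ.source := mem_chart_source E p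
  have hsymm : χ.symm (χ p) = p := χ.left_inv hpχ
  have hχs := contMDiffAt_symm_of_mem_maximalAtlas hχ (χ.map_source hpχ)
  have hsum : HasFDerivAt (glue ρ g ∘ χ.symm)
      (∑ i ∈ s, ρ i p • fderiv ℝ (g i ∘ χ.symm) (χ p)) (χ p) := by
    have h4 : HasFDerivAt (fun x ↦ ∑ i ∈ s, (ρ i ∘ χ.symm) x • (g i ∘ χ.symm) x)
        (∑ i ∈ s, ρ i p • fderiv ℝ (g i ∘ χ.symm) (χ p)) (χ p) := by
      refine HasFDerivAt.fun_sum fun i hi ↦ ?_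
      refine ((differentiableAt_comp_symm hχ hpχ (hd i)).hasFDerivAt.smul
        (differentiableAt_comp_symm hχ hpχ (hgd i hi)).hasFDerivAt).congr_fderiv ?_
      ext w
      simp [hsymm, hg0 i (h1 i hi)]
    refine h4.congr_of_eventuallyEq ?_
    have htend : Tendsto χ.symm (𝓝 (χ p)) (𝓝 p) := by
      simpa only [hsymm] using hχs.continuousAt.tendsto
    exact htend.eventually h3
  have h7 : mvfderiv 𝓘(ℝ, E) (glue ρ g) p v = ∑ i ∈ s, ρ i p • mvfderiv 𝓘(ℝ, E) (g i) p v := by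
    rw [mvfderiv_eq_fderiv_comp hχ hpχ ((h.contMDiffAt_glue hp hg).mdifferentiableAt hne),
      hsum.fderiv, ContinuousLinearMap.comp_apply, sum_apply]
    refine Finset.sum_congr rfl fun i hi ↦ ?_
    rw [mvfderiv_eq_fderiv_comp hχ hpχ (hgd i hi)]
    rfl
  rw [h7, map_sum, Finset.sum_congr rfl fun i hi ↦ by rw [map_smul, hv i (h1 i hi)],
    ← Finset.sum_smul, h2, one_smul]

end IsOpenPartition

end

/-! ### Smooth families of closed projections, and derivatives of charts. -/

noncomputable section

open Filter Topology

section ClosedProjection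

variable {G H : Type*} [NormedAddCommGroup G] [InnerProductSpace ℝ G] [FiniteDimensional ℝ G]
  [NormedAddCommGroup H] [InnerProductSpace ℝ H] [CompleteSpace H]

/-- The orthogonal projection to the closure of `K`. -/
def closedProjection (K : Submodule ℝ H) : H →L[ℝ] H :=
  K.topologicalClosure.starProjection

theorem closedProjection_mem (K : Submodule ℝ H) [FiniteDimensional ℝ K] (h : H) :
    closedProjection K h ∈ K := by
  have h1 : closedProjection K h ∈ K.topologicalClosure := Submodule.starProjection_apply_mem _ h
  rwa [K.closed_of_finiteDimensional.submodule_topologicalClosure_eq] at h1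

theorem closedProjection_apply {K : Submodule ℝ H} {h : H} (hh : h ∈ K) :
    closedProjection K h = h :=
  Submodule.starProjection_eq_self_iff.2 (K.le_topologicalClosure hh)

theorem closedProjection_eq_zero_iff {K : Submodule ℝ H} {h : H} :
    closedProjection K h = 0 ↔ h ∈ Kᗮ := by
  rw [closedProjection, Submodule.starProjection_apply_eq_zero_iff, Submodule.orthogonal_closure]

theorem isIdempotentElem_closedProjection (K : Submodule ℝ H) :
    IsIdempotentElem (closedProjection K) :=
  Submodule.isIdempotentElem_starProjection _

theorem sub_closedProjection_mem (K : Submodule ℝ H) (h : H) : h - closedProjection K h ∈ Kᗮ := by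
  rw [← Submodule.orthogonal_closure]
  exact Submodule.sub_starProjection_mem_orthogonal h

theorem closedProjection_range_eq {L : G →L[ℝ] H} (hL : Function.Injective L) :
    closedProjection (LinearMap.range L.toLinearMap) =
      L ∘L Ring.inverse (L.adjoint ∘L L) ∘L L.adjoint := by
  rw [← starProjection_range_eq hL]
  simp only [closedProjection]
  congr 1
  exact (Submodule.closed_of_finiteDimensional _).submodule_topologicalClosure_eq

/-- Injectivity of `L` amounts to invertibility of `L* L` on the finite-dimensional `G`, and units
form an open set. -/
theorem eventually_injective {L : G →L[ℝ] H} (hL : Function.Injective L) :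
    ∀ᶠ L' in 𝓝 L, Function.Injective (L' : G →L[ℝ] H) := by
  have hadj : Continuous (fun L : G →L[ℝ] H ↦ L.adjoint ∘L L) :=
    (ContinuousLinearMap.adjoint (𝕜 := ℝ) (E := G) (F := H)).continuous.clm_comp continuous_id
  filter_upwards [hadj.continuousAt.eventually
    (Units.isOpen.mem_nhds (isUnit_adjoint_comp_self hL))] with L' hL'
  have h1 : IsUnit (L'.adjoint ∘L L') := hL'
  rw [ContinuousLinearMap.isUnit_iff_bijective] at h1
  exact Function.Injective.of_comp (f := L'.adjoint) h1.1

variable {E : Type*} [NormedAddCommGroup E] [NormedSpace ℝ E]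
  {P : Type*} [TopologicalSpace P] [ChartedSpace E P]

theorem contMDiffAt_closedProjection {K : P → Submodule ℝ H} {L : P → G →L[ℝ] H} {p : P}
    (hL : ContMDiffAt 𝓘(ℝ, E) 𝓘(ℝ, G →L[ℝ] H) ∞ L p) (hinj : Function.Injective (L p))
    (hK : ∀ᶠ q in 𝓝 p, K q = LinearMap.range (L q).toLinearMap) :
    ContMDiffAt 𝓘(ℝ, E) 𝓘(ℝ, H →L[ℝ] H) ∞ (fun q ↦ closedProjection (K q)) p := by
  have h := (contDiffAt_starProjection_range hinj).contMDiffAt.comp p hL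
  refine h.congr_of_eventuallyEq ?_
  filter_upwards [hK, hL.continuousAt.eventually (eventually_injective hinj)] with q hq hq'
  rw [hq, closedProjection_range_eq hq']
  rfl

end ClosedProjection

section Chart

variable {E : Type*} [NormedAddCommGroup E] [NormedSpace ℝ E]
  {P : Type*} [TopologicalSpace P] [ChartedSpace E P]

theorem mvfderiv_chart_bijective [IsManifold 𝓘(ℝ, E) ∞ P] {φ : OpenPartialHomeomorph P E}
    (hφ : φ ∈ IsManifold.maximalAtlas 𝓘(ℝ, E) ∞ P) {p : P} (hp : p ∈ φ.source) :
    Function.Bijective (mvfderiv 𝓘(ℝ, E) φ p) := by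
  have h1 : φ.MDifferentiable 𝓘(ℝ, E) 𝓘(ℝ, E) :=
    ⟨(contMDiffOn_of_mem_maximalAtlas hφ).mdifferentiableOn (by simp),
      (contMDiffOn_symm_of_mem_maximalAtlas hφ).mdifferentiableOn (by simp)⟩
  exact h1.mfderiv_bijective hp

/-- The derivative of a chart as a linear equivalence. -/
def chartDerivEquiv [IsManifold 𝓘(ℝ, E) ∞ P] {φ : OpenPartialHomeomorph P E}
    (hφ : φ ∈ IsManifold.maximalAtlas 𝓘(ℝ, E) ∞ P) {p : P} (hp : p ∈ φ.source) :
    TangentSpace 𝓘(ℝ, E) p ≃ₗ[ℝ] E :=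
  LinearEquiv.ofBijective (mvfderiv 𝓘(ℝ, E) φ p).toLinearMap (mvfderiv_chart_bijective hφ hp)

theorem chartDerivEquiv_apply [IsManifold 𝓘(ℝ, E) ∞ P] {φ : OpenPartialHomeomorph P E}
    (hφ : φ ∈ IsManifold.maximalAtlas 𝓘(ℝ, E) ∞ P) {p : P} (hp : p ∈ φ.source)
    (v : TangentSpace 𝓘(ℝ, E) p) :
    chartDerivEquiv hφ hp v = mvfderiv 𝓘(ℝ, E) φ p v := rfl

theorem contDiffAt_comp_symm {X : Type*} [NormedAddCommGroup X] [NormedSpace ℝ X] {f : P → X}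
    {φ : OpenPartialHomeomorph P E} (hφ : φ ∈ IsManifold.maximalAtlas 𝓘(ℝ, E) ∞ P) {x : E}
    (hx : x ∈ φ.target) (hf : ContMDiffAt 𝓘(ℝ, E) 𝓘(ℝ, X) ∞ f (φ.symm x)) :
    ContDiffAt ℝ ∞ (f ∘ φ.symm) x :=
  (hf.comp x (contMDiffAt_symm_of_mem_maximalAtlas hφ hx)).contDiffAt

end Chart

/-! ### Immersion of the union of chart domains in a Hilbert space. -/

section Immersion

variable {E : Type*} [NormedAddCommGroup E] [NormedSpace ℝ E] [FiniteDimensional ℝ E]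
  {P : Type*} [TopologicalSpace P] [ChartedSpace E P] {ι : Type*}

variable (E ι) in
/-- A Hilbert space with a copy of `E × ℝ` for each index. -/
abbrev HilbertModel : Type _ :=
  lp (fun _ : ι ↦ EuclideanSpace ℝ (Fin (Module.finrank ℝ (E × ℝ)))) 2

/-- The map to the Hilbert space with the components `(ρ i • φ i, ρ i)`. -/
def hilbertMap (φ : ι → OpenPartialHomeomorph P E) (ρ : ι → P → ℝ) : P → HilbertModel E ι :=
  open Classical in
  glue ρ fun i q ↦ lp.singleContinuousLinearMap ℝ _ 2 i (toEuclidean (φ i q, (1 : ℝ)))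

variable {φ : ι → OpenPartialHomeomorph P E} {U : ι → Set P} {ρ : ι → P → ℝ} {p : P}

theorem contMDiffAt_hilbertMap [IsManifold 𝓘(ℝ, E) ∞ P]
    (hφ : ∀ i, φ i ∈ IsManifold.maximalAtlas 𝓘(ℝ, E) ∞ P)
    (hU : ∀ i, U i ⊆ (φ i).source) (hρ : IsOpenPartition E U ρ) (hp : p ∈ ⋃ i, U i) :
    ContMDiffAt 𝓘(ℝ, E) 𝓘(ℝ, HilbertModel E ι) ∞ (hilbertMap φ ρ) p := by
  classical
  refine hρ.contMDiffAt_glue hp fun i hi ↦ ?_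
  have h1 : ContMDiffAt 𝓘(ℝ, E) 𝓘(ℝ, E) ∞ (φ i) p :=
    contMDiffAt_of_mem_maximalAtlas (hφ i) (hU i hi)
  have h2 : ContDiff ℝ ∞ fun x : E ↦ lp.singleContinuousLinearMap ℝ
      (fun _ : ι ↦ EuclideanSpace ℝ (Fin (Module.finrank ℝ (E × ℝ)))) 2 i
      (toEuclidean (x, (1 : ℝ))) :=
    (ContinuousLinearMap.contDiff _).comp
      (toEuclidean.contDiff.comp (contDiff_id.prodMk contDiff_const))
  exact h2.contMDiff.contMDiffAt.comp p h1

/-- Choose `i` with `ρ i p ≠ 0`. The extra real coordinate shows that `dρ i` kills `v`; then the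
component `ρ i • φ i` gives `ρ i p • dφ i (v) = 0`. -/
theorem mvfderiv_hilbertMap_injective [IsManifold 𝓘(ℝ, E) ∞ P]
    (hφ : ∀ i, φ i ∈ IsManifold.maximalAtlas 𝓘(ℝ, E) ∞ P)
    (hU : ∀ i, U i ⊆ (φ i).source) (hρ : IsOpenPartition E U ρ) (hp : p ∈ ⋃ i, U i) :
    Function.Injective (mvfderiv 𝓘(ℝ, E) (hilbertMap φ ρ) p) := by
  classical
  have hne : (∞ : WithTop ℕ∞) ≠ 0 := by simp
  refine (injective_iff_map_eq_zero _).2 fun v hv ↦ ?_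
  obtain ⟨s, h1, h2, h3⟩ := hρ.exists_glue_eq hp (fun i q ↦ lp.singleContinuousLinearMap ℝ
    (fun _ : ι ↦ EuclideanSpace ℝ (Fin (Module.finrank ℝ (E × ℝ)))) 2 i
    (toEuclidean (φ i q, (1 : ℝ))))
  obtain ⟨i, his, hi⟩ : ∃ i ∈ s, ρ i p ≠ 0 := by
    by_contra! h0
    rw [Finset.sum_eq_zero h0] at h2
    exact zero_ne_one h2
  have hpi := hU i (h1 i his)
  have hsymm : (φ i).symm (φ i p) = p := (φ i).left_inv hpi
  let ev : HilbertModel E ι →L[ℝ] E × ℝ :=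
    (toEuclidean (E := E × ℝ)).symm.toContinuousLinearMap ∘L lp.evalCLM ℝ _ 2 i
  have hev : ev ∘ hilbertMap φ ρ =ᶠ[𝓝 p] fun q ↦ (ρ i q • φ i q, ρ i q) := by
    filter_upwards [h3] with q hq
    have hq' : hilbertMap φ ρ q = _ := hq
    have h4 : lp.evalCLM ℝ (fun _ : ι ↦ EuclideanSpace ℝ (Fin (Module.finrank ℝ (E × ℝ)))) 2 i
        (hilbertMap φ ρ q) = ρ i q • toEuclidean (φ i q, (1 : ℝ)) := by
      rw [hq', map_sum, Finset.sum_eq_single_of_mem i his]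
      · rw [map_smul]
        congr 1
        exact lp.single_apply_self 2 i _
      · intro j _ hj
        rw [map_smul]
        have : lp.evalCLM ℝ (fun _ : ι ↦ EuclideanSpace ℝ (Fin (Module.finrank ℝ (E × ℝ)))) 2 i
          (lp.singleContinuousLinearMap ℝ _ 2 j (toEuclidean (φ j q, (1 : ℝ)))) = 0 :=
          lp.single_apply_ne 2 j _ hj.symm
        rw [this, smul_zero]
    change (toEuclidean (E := E × ℝ)).symm (lp.evalCLM ℝ _ 2 i (hilbertMap φ ρ q)) = _
    rw [h4, map_smul, ContinuousLinearEquiv.symm_apply_apply]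
    simp
  have htend : Tendsto (φ i).symm (𝓝 (φ i p)) (𝓝 p) := by
    simpa only [hsymm] using ((φ i).continuousAt_symm ((φ i).map_source hpi)).tendsto
  have hΦ := (contMDiffAt_hilbertMap hφ hU hρ hp).mdifferentiableAt hne
  have hr := differentiableAt_comp_symm (hφ i) hpi ((hρ.contMDiffAt i p hp).mdifferentiableAt hne)
  rw [mvfderiv_eq_fderiv_comp (hφ i) hpi hΦ] at hv
  set w : E := mvfderiv 𝓘(ℝ, E) (φ i) p v with hw
  have hv' : fderiv ℝ (hilbertMap φ ρ ∘ (φ i).symm) (φ i p) w = 0 := hv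
  have hd1 := ev.hasFDerivAt.comp (φ i p) (differentiableAt_comp_symm (hφ i) hpi hΦ).hasFDerivAt
  have hd2 : HasFDerivAt (fun x : E ↦ ((ρ i ∘ (φ i).symm) x • x, (ρ i ∘ (φ i).symm) x)) _
    (φ i p) := (hr.hasFDerivAt.smul (hasFDerivAt_id (φ i p))).prodMk hr.hasFDerivAt
  have heq : ev ∘ hilbertMap φ ρ ∘ (φ i).symm =ᶠ[𝓝 (φ i p)]
      fun x : E ↦ ((ρ i ∘ (φ i).symm) x • x, (ρ i ∘ (φ i).symm) x) := by
    filter_upwards [htend.eventually hev,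
      (φ i).open_target.mem_nhds ((φ i).map_source hpi)] with x hx hxt
    simpa [(φ i).right_inv hxt] using! hx
  have hd3 := DFunLike.congr_fun (hd1.unique (hd2.congr_of_eventuallyEq heq)) w
  rw [ContinuousLinearMap.comp_apply, hv', map_zero] at hd3
  have h5 : fderiv ℝ (ρ i ∘ (φ i).symm) (φ i p) w = 0 := (congrArg Prod.snd hd3).symm
  have h6 : ρ i p • w = 0 := by
    have := (congrArg Prod.fst hd3).symm
    simpa [h5, hsymm] using! this
  have hw0 : w = 0 := (smul_eq_zero.1 h6).resolve_left hi
  exact (mvfderiv_chart_bijective (hφ i) hpi).1 (by rw [← hw, hw0, map_zero])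

end Immersion

end

/-! ### The bivector pushed forward to the Hilbert space. -/

noncomputable section

open Filter Topology

namespace PoissonLinear

variable {V : Type*} [AddCommGroup V] [Module ℝ V]
  {H : Type*} [NormedAddCommGroup H] [InnerProductSpace ℝ H] {κ : Type*} [Fintype κ]

/-- The image under `J : V → H` of the bivector `β` on `V`, as an operator on `H`. -/
def bivectorOperator (b : Module.Basis κ ℝ V)
    (β : Module.Dual ℝ V →ₗ[ℝ] Module.Dual ℝ V →ₗ[ℝ] ℝ) (J : V →ₗ[ℝ] H) : H →L[ℝ] H :=
  ∑ a, ∑ c, β (b.coord a) (b.coord c) • (innerSL ℝ (J (b a))).smulRight (J (b c))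

theorem inner_bivectorOperator (b : Module.Basis κ ℝ V)
    (β : Module.Dual ℝ V →ₗ[ℝ] Module.Dual ℝ V →ₗ[ℝ] ℝ) (J : V →ₗ[ℝ] H) (h h' : H) :
    inner ℝ (bivectorOperator b β J h) h' = β (pullbackInner J h) (pullbackInner J h') := by
  have hexp (h : H) : pullbackInner J h = ∑ a, inner ℝ h (J (b a)) • b.coord a := by
    refine b.ext fun c ↦ ?_
    classical
    simp [Finsupp.single_apply]
  rw [hexp h, hexp h']
  simp only [bivectorOperator, sum_apply, sum_inner, map_sum, map_smul, LinearMap.sum_apply,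
    LinearMap.smul_apply, smul_apply, ContinuousLinearMap.smulRight_apply, innerSL_apply_apply,
    inner_smul_left, smul_eq_mul, Finset.mul_sum]
  conv_rhs => rw [Finset.sum_comm]
  refine Finset.sum_congr rfl fun a _ ↦ Finset.sum_congr rfl fun c _ ↦ ?_
  rw [real_inner_comm (J (b a)), real_inner_comm (J (b c))]
  simp
  ring

/-- Lets smoothness be checked in chart bases, although `hilbertOperator` is defined with an
unrelated basis in each tangent space. -/
theorem bivectorOperator_eq {κ' : Type*} [Fintype κ'] (b : Module.Basis κ ℝ V)
    (b' : Module.Basis κ' ℝ V) (β : Module.Dual ℝ V →ₗ[ℝ] Module.Dual ℝ V →ₗ[ℝ] ℝ)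
    (J : V →ₗ[ℝ] H) : bivectorOperator b β J = bivectorOperator b' β J := by
  ext h
  refine ext_inner_right ℝ fun h' ↦ ?_
  rw [inner_bivectorOperator, inner_bivectorOperator]

/-- Compressing the image of a bivector to the orthogonal complement of `J W` gives an operator
that represents the bivector on `W°`. -/
theorem represents_compression [CompleteSpace H] [FiniteDimensional ℝ V]
    (b : Module.Basis κ ℝ V)
    (β : Module.Dual ℝ V →ₗ[ℝ] Module.Dual ℝ V →ₗ[ℝ] ℝ) (J : V →ₗ[ℝ] H) (W : Submodule ℝ V) :
    Represents (sharp β) J W ((1 - closedProjection (W.map J)) ∘L bivectorOperator b β J ∘L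
      (1 - closedProjection (W.map J))) := by
  have h1 {h : H} (hh : h ∈ (W.map J)ᗮ) : (1 - closedProjection (W.map J)) h = h := by
    simp [closedProjection_eq_zero_iff.2 hh]
  have h2 (h : H) : (1 - closedProjection (W.map J)) h ∈ (W.map J)ᗮ :=
    sub_closedProjection_mem _ h
  refine ⟨fun h hh h' hh' ↦ ?_, fun h hh ↦ ?_, fun h ↦ h2 _⟩
  · rw [ContinuousLinearMap.comp_apply, ContinuousLinearMap.comp_apply, h1 hh, apply_sharp,
      ← inner_bivectorOperator b]
    change inner ℝ (bivectorOperator b β J h - closedProjection _ _) h' = _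
    rw [inner_sub_left, (Submodule.mem_orthogonal _ _).1 hh' _ (closedProjection_mem _ _),
      sub_zero]
  · have : (1 - closedProjection (W.map J)) h = 0 := by simp [closedProjection_apply hh]
    rw [ContinuousLinearMap.comp_apply, ContinuousLinearMap.comp_apply, this, map_zero, map_zero]

end PoissonLinear

variable {E : Type*} [NormedAddCommGroup E] [NormedSpace ℝ E] [FiniteDimensional ℝ E]
  {P : Type*} [TopologicalSpace P] [ChartedSpace E P]
  {H : Type*} [NormedAddCommGroup H] [InnerProductSpace ℝ H]

namespace BivectorField

/-- The image of a bivector field under the derivative of a map to a Hilbert space. -/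
def hilbertOperator (B : BivectorField E P) (Φ : P → H) (q : P) : H →L[ℝ] H :=
  PoissonLinear.bivectorOperator (Module.finBasis ℝ (TangentSpace 𝓘(ℝ, E) q)) (B.toFun q)
    (mvfderiv 𝓘(ℝ, E) Φ q).toLinearMap

theorem contMDiffAt_hilbertOperator [IsManifold 𝓘(ℝ, E) ∞ P] (B : BivectorField E P) {Φ : P → H}
    {p : P} (hΦ : ∀ᶠ q in 𝓝 p, ContMDiffAt 𝓘(ℝ, E) 𝓘(ℝ, H) ∞ Φ q) :
    ContMDiffAt 𝓘(ℝ, E) 𝓘(ℝ, H →L[ℝ] H) ∞ (B.hilbertOperator Φ) p := by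
  have hne : (∞ : WithTop ℕ∞) ≠ 0 := by simp
  let χ := chartAt E p
  have hχ : χ ∈ IsManifold.maximalAtlas 𝓘(ℝ, E) ∞ P := IsManifold.chart_mem_maximalAtlas p
  have hpχ : p ∈ χ.source := mem_chart_source E p
  let b := Module.finBasis ℝ E
  let D : P → E →L[ℝ] H := fun q ↦ fderiv ℝ (Φ ∘ χ.symm) (χ q)
  have hD : ContMDiffAt 𝓘(ℝ, E) 𝓘(ℝ, E →L[ℝ] H) ∞ D p := by
    have h1 : ContDiffAt ℝ ∞ (Φ ∘ χ.symm) (χ p) := contDiffAt_comp_symm hχ (χ.map_source hpχ)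
      (by rw [χ.left_inv hpχ]; exact hΦ.self_of_nhds)
    have h2 : ContDiffAt ℝ ∞ (fderiv ℝ (Φ ∘ χ.symm)) (χ p) := h1.fderiv_right (by simp)
    exact h2.contMDiffAt.comp p (contMDiffAt_of_mem_maximalAtlas hχ hpχ)
  have hDv (v : E) : ContMDiffAt 𝓘(ℝ, E) 𝓘(ℝ, H) ∞ (fun q ↦ D q v) p :=
    hD.clm_apply contMDiffAt_const
  have hsmooth : ContMDiffAt 𝓘(ℝ, E) 𝓘(ℝ, H →L[ℝ] H) ∞ (fun q ↦ ∑ a, ∑ c,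
      B.toFun q (chartCovector E p (b.coord a) q) (chartCovector E p (b.coord c) q) •
        (innerSL ℝ (D q (b a))).smulRight (D q (b c))) p := by
    refine contMDiffAt_finsetSum fun a _ ↦ contMDiffAt_finsetSum fun c _ ↦ ?_
    refine ((B.contMDiffOn p _ _).contMDiffAt (χ.open_source.mem_nhds hpχ)).smul ?_
    have h1 : ContMDiffAt 𝓘(ℝ, E) 𝓘(ℝ, H →L[ℝ] ℝ) ∞ (fun q ↦ innerSL ℝ (D q (b a))) p :=
      (innerSL ℝ (E := H)).contMDiff.contMDiffAt.comp p (hDv (b a))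
    have hR : ContMDiff 𝓘(ℝ, H →L[ℝ] ℝ) 𝓘(ℝ, H →L[ℝ] H →L[ℝ] H) ∞
        (ContinuousLinearMap.smulRightL ℝ H H) := ContinuousLinearMap.contMDiff _
    have h2 : ContMDiffAt 𝓘(ℝ, E) 𝓘(ℝ, H →L[ℝ] H →L[ℝ] H) ∞
        (fun q ↦ ContinuousLinearMap.smulRightL ℝ H H (innerSL ℝ (D q (b a)))) p :=
      hR.contMDiffAt.comp p h1
    exact h2.clm_apply (hDv (b c))
  refine hsmooth.congr_of_eventuallyEq ?_
  filter_upwards [hΦ, χ.open_source.mem_nhds hpχ] with q hq hqχ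
  rw [hilbertOperator, PoissonLinear.bivectorOperator_eq _ (b.map (chartDerivEquiv hχ hqχ).symm)]
  have hJ (v : E) : mvfderiv 𝓘(ℝ, E) Φ q ((chartDerivEquiv hχ hqχ).symm v) = D q v := by
    rw [mvfderiv_eq_fderiv_comp hχ hqχ (hq.mdifferentiableAt hne)]
    change fderiv ℝ (Φ ∘ χ.symm) (χ q) (chartDerivEquiv hχ hqχ _) = _
    rw [LinearEquiv.apply_symm_apply]
  have hc (a) : (b.map (chartDerivEquiv hχ hqχ).symm).coord a = chartCovector E p (b.coord a) q := by
    ext v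
    rfl
  simp only [PoissonLinear.bivectorOperator, hc, Module.Basis.map_apply,
    ContinuousLinearMap.coe_coe, hJ]

end BivectorField

end

/-! ### Slice charts and local retractions to `C`. -/

noncomputable section

open Filter Topology

variable {E : Type*} [NormedAddCommGroup E] [NormedSpace ℝ E]
  {P : Type*} [TopologicalSpace P] [ChartedSpace E P]
  {H : Type*} [NormedAddCommGroup H] [InnerProductSpace ℝ H]

theorem IsSliceChart.of_mem_source {S : Set P} {p q : P} {φ : OpenPartialHomeomorph P E}
    {F : Submodule ℝ E} (h : IsSliceChart S p φ F) (hq : q ∈ φ.source) : IsSliceChart S q φ F :=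
  ⟨h.mem_maximalAtlas, hq, h.mem_iff⟩

theorem IsSliceChart.mem_submanifoldTangent_iff [IsManifold 𝓘(ℝ, E) ∞ P] [FiniteDimensional ℝ E]
    {S : Set P} {p : P} (hp : p ∈ S) {φ : OpenPartialHomeomorph P E} {F : Submodule ℝ E}
    (h : IsSliceChart S p φ F) (v : TangentSpace 𝓘(ℝ, E) p) :
    v ∈ submanifoldTangent E S p ↔ mvfderiv 𝓘(ℝ, E) φ p v ∈ F := by
  rw [submanifoldTangent_eq hp h]
  rfl

theorem IsSliceChart.submanifoldTangent_eq_map [IsManifold 𝓘(ℝ, E) ∞ P] [FiniteDimensional ℝ E]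
    {S : Set P} {p : P} (hp : p ∈ S) {φ : OpenPartialHomeomorph P E} {F : Submodule ℝ E}
    (h : IsSliceChart S p φ F) :
    submanifoldTangent E S p =
      F.map (chartDerivEquiv h.mem_maximalAtlas h.mem_source).symm.toLinearMap := by
  ext v
  rw [h.mem_submanifoldTangent_iff hp, Submodule.mem_map]
  constructor
  · exact fun hv ↦ ⟨_, hv, LinearEquiv.symm_apply_apply _ v⟩
  · rintro ⟨x, hx, rfl⟩
    rw [← chartDerivEquiv_apply h.mem_maximalAtlas h.mem_source]
    change chartDerivEquiv _ _ ((chartDerivEquiv _ _).symm x) ∈ F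
    rwa [LinearEquiv.apply_symm_apply]

theorem IsSliceChart.finrank_submanifoldTangent [IsManifold 𝓘(ℝ, E) ∞ P]
    [FiniteDimensional ℝ E] {S : Set P} {p : P} (hp : p ∈ S) {φ : OpenPartialHomeomorph P E}
    {F : Submodule ℝ E} (h : IsSliceChart S p φ F) :
    Module.finrank ℝ (submanifoldTangent E S p) = Module.finrank ℝ F := by
  rw [h.submanifoldTangent_eq_map hp]
  exact LinearEquiv.finrank_map_eq _ F

theorem mvfderiv_chartDerivEquiv_symm [IsManifold 𝓘(ℝ, E) ∞ P] {Φ : P → H} {p : P}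
    {φ : OpenPartialHomeomorph P E} (hφ : φ ∈ IsManifold.maximalAtlas 𝓘(ℝ, E) ∞ P)
    (hp : p ∈ φ.source) (hΦ : MDifferentiableAt 𝓘(ℝ, E) 𝓘(ℝ, H) Φ p) (x : E) :
    mvfderiv 𝓘(ℝ, E) Φ p ((chartDerivEquiv hφ hp).symm x) =
      fderiv ℝ (Φ ∘ φ.symm) (φ p) x := by
  rw [mvfderiv_eq_fderiv_comp hφ hp hΦ]
  change fderiv ℝ (Φ ∘ φ.symm) (φ p) (chartDerivEquiv hφ hp _) = _
  rw [LinearEquiv.apply_symm_apply]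

variable (E) in
/-- A slice chart for `C` around `p`, with a linear projection to the slice. -/
structure SliceRetraction (C : Set P) (p : P) where
  /-- The slice chart. -/
  chart : OpenPartialHomeomorph P E
  /-- The linear subspace that is the image of `C`. -/
  model : Submodule ℝ E
  isSliceChart : IsSliceChart C p chart model
  /-- The projection to the subspace. -/
  proj : E →L[ℝ] E
  proj_mem : ∀ x, proj x ∈ model
  proj_apply : ∀ x ∈ model, proj x = x

theorem IsSliceChart.exists_sliceRetraction [FiniteDimensional ℝ E] {C : Set P} {p : P}
    {φ : OpenPartialHomeomorph P E} {F : Submodule ℝ E} (h : IsSliceChart C p φ F) :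
    Nonempty (SliceRetraction E C p) := by
  obtain ⟨g, hg⟩ := F.subtype.exists_leftInverse_of_injective F.ker_subtype
  refine ⟨⟨φ, F, h, (F.subtype ∘ₗ g).toContinuousLinearMap, fun x ↦ (g x).2, fun x hx ↦ ?_⟩⟩
  have := LinearMap.congr_fun hg ⟨x, hx⟩
  change ((g x : F) : E) = x
  exact congrArg Subtype.val this

namespace SliceRetraction

variable {C : Set P} {p q : P} (d : SliceRetraction E C p)

/-- The domain of the retraction. -/
def domain : Set P :=
  d.chart.source ∩ d.chart ⁻¹' (d.proj ⁻¹' d.chart.target)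

/-- The local retraction to `C`. -/
def retract (q : P) : P :=
  d.chart.symm (d.proj (d.chart q))

theorem domain_subset : d.domain ⊆ d.chart.source := Set.inter_subset_left

theorem isOpen_domain : IsOpen d.domain :=
  d.chart.isOpen_inter_preimage (d.chart.open_target.preimage d.proj.continuous)

theorem chart_mem_model (hq : q ∈ d.chart.source) (hC : q ∈ C) : d.chart q ∈ d.model :=
  (d.isSliceChart.mem_iff q hq).1 hC

theorem mem_domain (hq : q ∈ d.chart.source) (hC : q ∈ C) : q ∈ d.domain := by
  refine ⟨hq, ?_⟩
  change d.proj (d.chart q) ∈ d.chart.target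
  rw [d.proj_apply _ (d.chart_mem_model hq hC)]
  exact d.chart.map_source hq

theorem retract_mem_source (hq : q ∈ d.domain) : d.retract q ∈ d.chart.source :=
  d.chart.map_target hq.2

theorem chart_retract (hq : q ∈ d.domain) : d.chart (d.retract q) = d.proj (d.chart q) :=
  d.chart.right_inv hq.2

theorem retract_mem (hq : q ∈ d.domain) : d.retract q ∈ C := by
  rw [d.isSliceChart.mem_iff _ (d.retract_mem_source hq), d.chart_retract hq]
  exact d.proj_mem _

theorem retract_eq (hq : q ∈ d.domain) (hC : q ∈ C) : d.retract q = q := by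
  rw [retract, d.proj_apply _ (d.chart_mem_model hq.1 hC), d.chart.left_inv hq.1]

theorem contMDiffAt_proj_chart (hq : q ∈ d.domain) :
    ContMDiffAt 𝓘(ℝ, E) 𝓘(ℝ, E) ∞ (fun q ↦ d.proj (d.chart q)) q :=
  d.proj.contMDiff.contMDiffAt.comp q
    (contMDiffAt_of_mem_maximalAtlas d.isSliceChart.mem_maximalAtlas hq.1)

theorem contMDiffAt_retract (hq : q ∈ d.domain) :
    ContMDiffAt 𝓘(ℝ, E) 𝓘(ℝ, E) ∞ d.retract q :=
  ContMDiffAt.comp (I' := 𝓘(ℝ, E)) q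
    (contMDiffAt_symm_of_mem_maximalAtlas d.isSliceChart.mem_maximalAtlas hq.2)
    (d.contMDiffAt_proj_chart hq)

/-- At points of `C`, the derivative of the retraction takes values in the tangent space of
`C`. -/
theorem mvfderiv_comp_retract_mem [IsManifold 𝓘(ℝ, E) ∞ P] [FiniteDimensional ℝ E]
    (hq : q ∈ d.domain) (hC : q ∈ C) {Φ : P → H}
    (hΦ : ContMDiffAt 𝓘(ℝ, E) 𝓘(ℝ, H) ∞ Φ q) (v : TangentSpace 𝓘(ℝ, E) q) :
    mvfderiv 𝓘(ℝ, E) (Φ ∘ d.retract) q v ∈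
      (submanifoldTangent E C q).map (mvfderiv 𝓘(ℝ, E) Φ q).toLinearMap := by
  have hne : (∞ : WithTop ℕ∞) ≠ 0 := by simp
  have hA := d.isSliceChart.mem_maximalAtlas
  have hr := d.retract_eq hq hC
  have hΦr : ContMDiffAt 𝓘(ℝ, E) 𝓘(ℝ, H) ∞ (Φ ∘ d.retract) q :=
    ContMDiffAt.comp q (by rwa [hr]) (d.contMDiffAt_retract hq)
  have hx : d.proj (d.chart q) = d.chart q := d.proj_apply _ (d.chart_mem_model hq.1 hC)
  have hd : HasFDerivAt (Φ ∘ d.chart.symm) (fderiv ℝ (Φ ∘ d.chart.symm) (d.chart q))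
      (d.proj (d.chart q)) := by
    rw [hx]
    exact (differentiableAt_comp_symm hA hq.1 (hΦ.mdifferentiableAt hne)).hasFDerivAt
  have hd2 := hd.comp (d.chart q) d.proj.hasFDerivAt
  have heq : (Φ ∘ d.retract) ∘ d.chart.symm =ᶠ[𝓝 (d.chart q)]
      (Φ ∘ d.chart.symm) ∘ d.proj := by
    filter_upwards [d.chart.open_target.mem_nhds (d.chart.map_source hq.1)] with x hx
    simp [retract, d.chart.right_inv hx]
  rw [mvfderiv_eq_fderiv_comp hA hq.1 (hΦr.mdifferentiableAt hne), heq.fderiv_eq, hd2.fderiv]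
  set w : E := mvfderiv 𝓘(ℝ, E) d.chart q v with hw
  change fderiv ℝ (Φ ∘ d.chart.symm) (d.chart q) (d.proj w) ∈ _
  rw [(d.isSliceChart.of_mem_source hq.1).submanifoldTangent_eq_map hC]
  refine ⟨_, ⟨d.proj w, d.proj_mem w, rfl⟩, ?_⟩
  exact mvfderiv_chartDerivEquiv_symm hA hq.1 (hΦ.mdifferentiableAt hne) _

end SliceRetraction

/-! ### Smoothness of the tangent and normal projections along `C`. -/

section NormalProjection

variable [CompleteSpace H]

/-- The orthogonal projection to the image in `H` of the tangent space of `C`. -/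
def tangentProjection (Φ : P → H) (C : Set P) (q : P) : H →L[ℝ] H :=
  closedProjection ((submanifoldTangent E C q).map (mvfderiv 𝓘(ℝ, E) Φ q).toLinearMap)

variable [FiniteDimensional ℝ E]

/-- The compression of the bivector to the orthogonal complement of the tangent space of `C`. -/
def normalOperator (B : BivectorField E P) (Φ : P → H) (C : Set P) (q : P) : H →L[ℝ] H :=
  (1 - tangentProjection (E := E) Φ C q) ∘L B.hilbertOperator Φ q ∘L
    (1 - tangentProjection (E := E) Φ C q)

/-- The orthogonal projection to the range of `normalOperator`. -/
def normalProjection (B : BivectorField E P) (Φ : P → H) (C : Set P) (q : P) : H →L[ℝ] H :=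
  closedProjection (LinearMap.range (normalOperator B Φ C q).toLinearMap)

theorem represents_normalOperator (B : BivectorField E P) (Φ : P → H) (C : Set P) (q : P) :
    PoissonLinear.Represents (B.sharp q) (mvfderiv 𝓘(ℝ, E) Φ q).toLinearMap
      (submanifoldTangent E C q) (normalOperator B Φ C q) :=
  PoissonLinear.represents_compression _ _ _ _

variable {B : BivectorField E P} {Φ : P → H} {C : Set P} {O : Set P} {p q : P}
  [IsManifold 𝓘(ℝ, E) ∞ P]

/-- In a slice chart, `TC` is the image of the fixed space `d.model`, so its image in `H` is the
range of a smooth family of injective operators. Composing with the retraction makes the field along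
`C` a function on an open set. -/
theorem SliceRetraction.contMDiffAt_tangentProjection (d : SliceRetraction E C p)
    (hΦ : ∀ q ∈ O, ContMDiffAt 𝓘(ℝ, E) 𝓘(ℝ, H) ∞ Φ q)
    (hinj : ∀ q ∈ O, Function.Injective (mvfderiv 𝓘(ℝ, E) Φ q)) (hCO : C ⊆ O)
    (hq : q ∈ d.domain) :
    ContMDiffAt 𝓘(ℝ, E) 𝓘(ℝ, H →L[ℝ] H) ∞
      (fun q ↦ tangentProjection (E := E) Φ C (d.retract q)) q := by
  have hne : (∞ : WithTop ℕ∞) ≠ 0 := by simp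
  have hA := d.isSliceChart.mem_maximalAtlas
  let e : EuclideanSpace ℝ (Fin (Module.finrank ℝ d.model)) →L[ℝ] E :=
    d.model.subtypeL ∘L (toEuclidean (E := d.model)).symm.toContinuousLinearMap
  have he : Function.Injective e :=
    d.model.injective_subtype.comp (toEuclidean (E := d.model)).symm.injective
  have he' : LinearMap.range e.toLinearMap = d.model := by
    apply le_antisymm
    · rintro _ ⟨x, rfl⟩
      exact ((toEuclidean (E := d.model)).symm x).2
    · intro x hx
      exact ⟨toEuclidean (⟨x, hx⟩ : d.model), by simp [e]⟩
  let D : P → E →L[ℝ] H := fun q ↦ fderiv ℝ (Φ ∘ d.chart.symm) (d.proj (d.chart q))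
  have hJD {q : P} (hq : q ∈ d.domain) (x : E) : mvfderiv 𝓘(ℝ, E) Φ (d.retract q)
      ((chartDerivEquiv hA (d.retract_mem_source hq)).symm x) = D q x := by
    rw [mvfderiv_chartDerivEquiv_symm hA (d.retract_mem_source hq)
      ((hΦ _ (hCO (d.retract_mem hq))).mdifferentiableAt hne), d.chart_retract hq]
  have hDinj : Function.Injective (D q) := by
    intro x y hxy
    rw [← hJD hq, ← hJD hq] at hxy
    exact (chartDerivEquiv hA (d.retract_mem_source hq)).symm.injective
      (hinj _ (hCO (d.retract_mem hq)) hxy)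
  refine contMDiffAt_closedProjection (L := fun q ↦ D q ∘L e) ?_ (hDinj.comp he) ?_
  · have h1 : ContDiffAt ℝ ∞ (Φ ∘ d.chart.symm) (d.proj (d.chart q)) :=
      contDiffAt_comp_symm hA hq.2 (hΦ _ (hCO (d.retract_mem hq)))
    have h2 : ContDiffAt ℝ ∞ (fderiv ℝ (Φ ∘ d.chart.symm)) (d.proj (d.chart q)) :=
      h1.fderiv_right (by simp)
    have h3 : ContMDiffAt 𝓘(ℝ, E) 𝓘(ℝ, E →L[ℝ] H) ∞ D q :=
      ContMDiffAt.comp (I' := 𝓘(ℝ, E)) q h2.contMDiffAt (d.contMDiffAt_proj_chart hq)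
    exact h3.clm_comp contMDiffAt_const
  · filter_upwards [d.isOpen_domain.mem_nhds hq] with q' hq'
    have hs := d.isSliceChart.of_mem_source (d.retract_mem_source hq')
    rw [hs.submanifoldTangent_eq_map (d.retract_mem hq'), ← Submodule.map_comp]
    have h1 : (D q' ∘L e).toLinearMap = (D q').toLinearMap ∘ₗ e.toLinearMap := rfl
    rw [h1, LinearMap.range_comp, he']
    congr 1
    ext x
    exact hJD hq' x

theorem SliceRetraction.contMDiffAt_normalOperator (d : SliceRetraction E C p)
    (hO : IsOpen O) (hΦ : ∀ q ∈ O, ContMDiffAt 𝓘(ℝ, E) 𝓘(ℝ, H) ∞ Φ q)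
    (hinj : ∀ q ∈ O, Function.Injective (mvfderiv 𝓘(ℝ, E) Φ q)) (hCO : C ⊆ O)
    (hq : q ∈ d.domain) :
    ContMDiffAt 𝓘(ℝ, E) 𝓘(ℝ, H →L[ℝ] H) ∞ (fun q ↦ normalOperator B Φ C (d.retract q)) q := by
  have h1 := d.contMDiffAt_tangentProjection hΦ hinj hCO hq
  have h2 : ContMDiffAt 𝓘(ℝ, E) 𝓘(ℝ, H →L[ℝ] H) ∞
      (fun q ↦ 1 - tangentProjection (E := E) Φ C (d.retract q)) q := contMDiffAt_const.sub h1
  have h3 : ContMDiffAt 𝓘(ℝ, E) 𝓘(ℝ, H →L[ℝ] H) ∞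
      (fun q ↦ B.hilbertOperator Φ (d.retract q)) q :=
    ContMDiffAt.comp (I' := 𝓘(ℝ, E)) (g := B.hilbertOperator Φ) q (B.contMDiffAt_hilbertOperator (by
      filter_upwards [hO.mem_nhds (hCO (d.retract_mem hq))] using hΦ)) (d.contMDiffAt_retract hq)
  exact h2.clm_comp (h3.clm_comp h2)

/-- Here constant rank is essential. Restricted to a fixed complement of its kernel at `q`, the
operator stays injective nearby; the range of the restriction then has the full rank `c` and
exhausts the range of the operator. -/
theorem SliceRetraction.contMDiffAt_normalProjection (d : SliceRetraction E C p)
    (hO : IsOpen O) (hΦ : ∀ q ∈ O, ContMDiffAt 𝓘(ℝ, E) 𝓘(ℝ, H) ∞ Φ q)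
    (hinj : ∀ q ∈ O, Function.Injective (mvfderiv 𝓘(ℝ, E) Φ q)) (hCO : C ⊆ O) {c : ℕ}
    (hc : ∀ q ∈ C, Module.finrank ℝ (LinearMap.range (normalOperator B Φ C q).toLinearMap) = c)
    (hq : q ∈ d.domain) :
    ContMDiffAt 𝓘(ℝ, E) 𝓘(ℝ, H →L[ℝ] H) ∞
      (fun q ↦ normalProjection B Φ C (d.retract q)) q := by
  have hfd {q : P} (hq : q ∈ C) :
      FiniteDimensional ℝ (LinearMap.range (normalOperator B Φ C q).toLinearMap) :=
    (represents_normalOperator B Φ C q).finiteDimensional_range (B.isSkew_sharp q)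
      (hinj q (hCO hq))
  have hA := d.contMDiffAt_normalOperator (B := B) hO hΦ hinj hCO hq
  set A : P → H →L[ℝ] H := fun q ↦ normalOperator B Φ C (d.retract q) with hAdef
  have := hfd (d.retract_mem hq)
  let R := LinearMap.range (A q).toLinearMap
  have hR : FiniteDimensional ℝ R := this
  obtain ⟨g, hg⟩ := (A q).toLinearMap.rangeRestrict.exists_rightInverse_of_surjective
    (LinearMap.range_rangeRestrict _)
  have hg' (y : R) : A q (g y) = y := congrArg Subtype.val (LinearMap.congr_fun hg y)
  let e : EuclideanSpace ℝ (Fin (Module.finrank ℝ R)) →L[ℝ] H :=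
    g.toContinuousLinearMap ∘L (toEuclidean (E := R)).symm.toContinuousLinearMap
  have hL : ContMDiffAt 𝓘(ℝ, E) 𝓘(ℝ, EuclideanSpace ℝ (Fin (Module.finrank ℝ R)) →L[ℝ] H) ∞
      (fun q ↦ A q ∘L e) q := hA.clm_comp contMDiffAt_const
  have hLinj : Function.Injective (A q ∘L e) := by
    intro x y hxy
    have h1 : A q (g ((toEuclidean (E := R)).symm x)) = A q (g ((toEuclidean (E := R)).symm y)) :=
      hxy
    rw [hg', hg'] at h1
    exact (toEuclidean (E := R)).symm.injective (Subtype.ext h1)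
  refine contMDiffAt_closedProjection (L := fun q ↦ A q ∘L e) hL hLinj ?_
  filter_upwards [d.isOpen_domain.mem_nhds hq,
    hL.continuousAt.eventually (eventually_injective hLinj)] with q' hq' hinj'
  have := hfd (d.retract_mem hq')
  symm
  refine Submodule.eq_of_le_of_finrank_eq ?_ ?_
  · rintro _ ⟨x, rfl⟩
    exact ⟨e x, rfl⟩
  · rw [hc _ (d.retract_mem hq')]
    refine (LinearMap.finrank_range_of_inj hinj').trans ?_
    rw [finrank_euclideanSpace_fin]
    exact hc _ (d.retract_mem hq)

end NormalProjection

end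

/-! ### Openness of the cosymplectic condition, and the extension of `C`. -/

noncomputable section

open Filter Topology

variable {E : Type*} [NormedAddCommGroup E] [NormedSpace ℝ E] [FiniteDimensional ℝ E]
  {P : Type*} [TopologicalSpace P] [ChartedSpace E P] [IsManifold 𝓘(ℝ, E) ∞ P]

/-- Being cosymplectic is an open condition on a submanifold. -/
theorem IsSliceChart.eventually_isCosymplectic (B : BivectorField E P) {S : Set P} {p : P}
    {φ : OpenPartialHomeomorph P E} {F : Submodule ℝ E} (h : IsSliceChart S p φ F)
    (hp : PoissonLinear.IsCosymplectic (B.sharp p)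
      (F.comap (mvfderiv 𝓘(ℝ, E) φ p).toLinearMap)) :
    ∀ᶠ q in 𝓝 p, PoissonLinear.IsCosymplectic (B.sharp q)
      (F.comap (mvfderiv 𝓘(ℝ, E) φ q).toLinearMap) := by
  have hA := h.mem_maximalAtlas
  let H := EuclideanSpace ℝ (Fin (Module.finrank ℝ E))
  let τ : E ≃L[ℝ] H := toEuclidean
  let Φ : P → H := τ ∘ φ
  have hφ {q : P} (hq : q ∈ φ.source) : ContMDiffAt 𝓘(ℝ, E) 𝓘(ℝ, E) ∞ φ q :=
    contMDiffAt_of_mem_maximalAtlas hA hq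
  have hΦ {q : P} (hq : q ∈ φ.source) : ContMDiffAt 𝓘(ℝ, E) 𝓘(ℝ, H) ∞ Φ q :=
    τ.contDiff.contMDiff.contMDiffAt.comp q (hφ hq)
  have hJ {q : P} (hq : q ∈ φ.source) (v : TangentSpace 𝓘(ℝ, E) q) :
      mvfderiv 𝓘(ℝ, E) Φ q v = τ (mvfderiv 𝓘(ℝ, E) φ q v) := by
    have h1 := mfderiv_comp (I := 𝓘(ℝ, E)) (I' := 𝓘(ℝ, E)) (I'' := 𝓘(ℝ, H)) q
      τ.differentiableAt.mdifferentiableAt ((hφ hq).mdifferentiableAt (by simp))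
    rw [mfderiv_eq_fderiv, τ.fderiv] at h1
    exact DFunLike.congr_fun h1 v
  have hJbij {q : P} (hq : q ∈ φ.source) : Function.Bijective (mvfderiv 𝓘(ℝ, E) Φ q) := by
    have h1 := τ.bijective.comp (mvfderiv_chart_bijective hA hq)
    have h2 : ⇑(mvfderiv 𝓘(ℝ, E) Φ q) = τ ∘ mvfderiv 𝓘(ℝ, E) φ q := funext (hJ hq)
    rwa [h2]
  -- In the slice chart the tangent spaces become the constant space `F`, so one space `R`
  -- parametrizes all the annihilators. The condition becomes injectivity of a continuous family of
  -- operators `N q` on `R`.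
  let R : Submodule ℝ H := (F.map τ.toLinearEquiv.toLinearMap)ᗮ
  have hT {q : P} (hq : q ∈ φ.source) (x : H) :
      PoissonLinear.pullbackInner (mvfderiv 𝓘(ℝ, E) Φ q).toLinearMap x ∈
        (F.comap (mvfderiv 𝓘(ℝ, E) φ q).toLinearMap).dualAnnihilator ↔ x ∈ R := by
    rw [PoissonLinear.pullbackInner_mem_dualAnnihilator]
    suffices hmap : (F.comap (mvfderiv 𝓘(ℝ, E) φ q).toLinearMap).map
        (mvfderiv 𝓘(ℝ, E) Φ q).toLinearMap = F.map τ.toLinearEquiv.toLinearMap by rw [hmap]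
    ext y
    constructor
    · rintro ⟨v, hv, rfl⟩
      exact ⟨_, hv, (hJ hq v).symm⟩
    · rintro ⟨w, hw, rfl⟩
      obtain ⟨v, rfl⟩ := (mvfderiv_chart_bijective hA hq).2 w
      exact ⟨v, hw, hJ hq v⟩
  let N : P → R →L[ℝ] R := fun q ↦ R.orthogonalProjectionOnto ∘L B.hilbertOperator Φ q ∘L R.subtypeL
  have hN (q : P) (x y : R) : inner ℝ (N q x) y =
      PoissonLinear.pullbackInner (mvfderiv 𝓘(ℝ, E) Φ q).toLinearMap (y : H) (B.sharp q
        (PoissonLinear.pullbackInner (mvfderiv 𝓘(ℝ, E) Φ q).toLinearMap (x : H))) := by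
    rw [BivectorField.sharp, PoissonLinear.apply_sharp,
      ← PoissonLinear.inner_bivectorOperator (Module.finBasis ℝ (TangentSpace 𝓘(ℝ, E) q))]
    change inner ℝ (R.orthogonalProjectionOnto (B.hilbertOperator Φ q x)) y = _
    rw [Submodule.inner_orthogonalProjectionOnto_eq_of_mem_right]
    rfl
  have hNp : Function.Injective (N p) := by
    refine (injective_iff_map_eq_zero _).2 fun x hx ↦ ?_
    have h1 := (hT h.mem_source x).2 x.2
    have h2 := hp.eq_zero h1 (by
      rw [← Subspace.forall_mem_dualAnnihilator_apply_eq_zero_iff]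
      intro η hη
      obtain ⟨y, rfl⟩ := PoissonLinear.pullbackInner_surjective
        (J := (mvfderiv 𝓘(ℝ, E) Φ p).toLinearMap) (hJbij h.mem_source).1 η
      rw [← hN p x ⟨y, (hT h.mem_source y).1 hη⟩, hx, inner_zero_left])
    obtain ⟨v, hv⟩ := (hJbij h.mem_source).2 x
    have h3 : inner ℝ (x : H) (mvfderiv 𝓘(ℝ, E) Φ p v) = 0 := LinearMap.congr_fun h2 v
    rw [hv, inner_self_eq_zero] at h3
    exact Subtype.ext h3
  have hNc : ContinuousAt N p := by
    have h1 : ContinuousAt (B.hilbertOperator Φ) p := by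
      refine (B.contMDiffAt_hilbertOperator ?_).continuousAt
      filter_upwards [φ.open_source.mem_nhds h.mem_source] with q hq using hΦ hq
    exact continuousAt_const.clm_comp (h1.clm_comp continuousAt_const)
  filter_upwards [hNc.eventually (eventually_injective hNp),
    φ.open_source.mem_nhds h.mem_source] with q hq hqs
  refine PoissonLinear.isCosymplectic_of_nondegenerate fun ξ hξ hsξ ↦ ?_
  obtain ⟨x, rfl⟩ := PoissonLinear.pullbackInner_surjective
    (J := (mvfderiv 𝓘(ℝ, E) Φ q).toLinearMap) (hJbij hqs).1 ξ
  have hx := (hT hqs x).1 hξ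
  have h0 : N q ⟨x, hx⟩ = 0 := by
    rw [← inner_self_eq_zero (𝕜 := ℝ), hN]
    exact (Submodule.mem_dualAnnihilator _).1 ((hT hqs _).2 (N q ⟨x, hx⟩).2) _ hsξ
  have hx0 : x = 0 := congrArg Subtype.val (hq (h0.trans (map_zero (N q)).symm))
  rw [hx0, map_zero]

/-- A submanifold that extends a pre-Poisson submanifold in the directions complementary to
`TC + ♯N*C`. -/
theorem PoissonStructure.IsPrePoisson.exists_extension [T2Space P] [SecondCountableTopology P]
    {B : PoissonStructure E P} {C : Set P} {k : ℕ} (hpre : B.IsPrePoisson C)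
    (hC : IsEmbeddedSubmanifold E C k) :
    ∃ (S : Set P) (m : ℕ), C ⊆ S ∧ ∀ p ∈ C, ∃ (φ : OpenPartialHomeomorph P E)
      (F : Submodule ℝ E), IsSliceChart S p φ F ∧ Module.finrank ℝ F = m ∧
      (F.comap (mvfderiv 𝓘(ℝ, E) φ p).toLinearMap).dualAnnihilator ⊓
        PoissonLinear.conormalKernel (B.sharp p) (submanifoldTangent E C p) = ⊥ ∧
      (F.comap (mvfderiv 𝓘(ℝ, E) φ p).toLinearMap).dualAnnihilator ⊔
        PoissonLinear.conormalKernel (B.sharp p) (submanifoldTangent E C p) =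
          (submanifoldTangent E C p).dualAnnihilator := by
  have hne : (∞ : WithTop ℕ∞) ≠ 0 := by simp
  obtain ⟨r, hr⟩ := hpre
  have hd (p : C) : Nonempty (SliceRetraction E C p.1) := by
    obtain ⟨φ, F, h, -⟩ := hC p p.2
    exact h.exists_sliceRetraction
  let d (p : C) : SliceRetraction E C p.1 := (hd p).some
  let U (i : C) : Set P := (d i).domain
  obtain ⟨ρ, hρ⟩ := exists_isOpenPartition (E := E) U fun i ↦ (d i).isOpen_domain
  let O : Set P := ⋃ i, U i
  have hO : IsOpen O := isOpen_iUnion fun i ↦ (d i).isOpen_domain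
  have hCO : C ⊆ O := fun p hp ↦ Set.mem_iUnion.2
    ⟨⟨p, hp⟩, (d ⟨p, hp⟩).mem_domain (d ⟨p, hp⟩).isSliceChart.mem_source hp⟩
  let H := HilbertModel E C
  let Φ : P → H := hilbertMap (fun i ↦ (d i).chart) ρ
  have hΦ : ∀ q ∈ O, ContMDiffAt 𝓘(ℝ, E) 𝓘(ℝ, H) ∞ Φ q := fun q hq ↦
    contMDiffAt_hilbertMap (fun i ↦ (d i).isSliceChart.mem_maximalAtlas)
      (fun i ↦ (d i).domain_subset) hρ hq
  have hinj : ∀ q ∈ O, Function.Injective (mvfderiv 𝓘(ℝ, E) Φ q) := fun q hq ↦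
    mvfderiv_hilbertMap_injective (fun i ↦ (d i).isSliceChart.mem_maximalAtlas)
      (fun i ↦ (d i).domain_subset) hρ hq
  let A : P → H →L[ℝ] H := normalOperator B.toBivectorField Φ C
  have hA (q : P) : PoissonLinear.Represents (B.sharp q) (mvfderiv 𝓘(ℝ, E) Φ q).toLinearMap
      (submanifoldTangent E C q) (A q) := represents_normalOperator B.toBivectorField Φ C q
  have hc : ∀ q ∈ C, Module.finrank ℝ (LinearMap.range (A q).toLinearMap) = r - k := by
    intro q hq
    have h1 := (hA q).finrank_range (B.isSkew_sharp q) (hinj q (hCO hq))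
    have h2 : Module.finrank ℝ ↥(submanifoldTangent E C q ⊔
      PoissonLinear.sharpAnn (B.sharp q) (submanifoldTangent E C q)) = r := hr q hq
    obtain ⟨φ, F, h3, h4⟩ := hC q hq
    rw [h2, h3.finrank_submanifoldTangent hq, h4] at h1
    exact Nat.eq_sub_of_add_eq h1
  -- All local retractions fix `C`, so along `C` the averages are exact: `M` is the normal
  -- projection and `f` vanishes. Off `C`, `M` is only close to an idempotent.
  let M : P → H →L[ℝ] H :=
    glue ρ fun i q ↦ normalProjection B.toBivectorField Φ C ((d i).retract q)
  let f : P → H := glue ρ fun i q ↦ Φ q - Φ ((d i).retract q)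
  have hM {q : P} (hq : q ∈ O) : ContMDiffAt 𝓘(ℝ, E) 𝓘(ℝ, H →L[ℝ] H) ∞ M q :=
    hρ.contMDiffAt_glue hq fun i hi ↦ (d i).contMDiffAt_normalProjection hO hΦ hinj hCO hc hi
  have hΦr (i : C) {q : P} (hi : q ∈ U i) :
      ContMDiffAt 𝓘(ℝ, E) 𝓘(ℝ, H) ∞ (Φ ∘ (d i).retract) q :=
    ContMDiffAt.comp q (hΦ _ (hCO ((d i).retract_mem hi))) ((d i).contMDiffAt_retract hi)
  have hf {q : P} (hq : q ∈ O) : ContMDiffAt 𝓘(ℝ, E) 𝓘(ℝ, H) ∞ f q :=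
    hρ.contMDiffAt_glue hq fun i hi ↦ (hΦ q hq).sub (hΦr i hi)
  have hMC {p : P} (hp : p ∈ C) : M p = normalProjection B.toBivectorField Φ C p :=
    hρ.glue_apply (hCO hp) fun i hi ↦ by rw [(d i).retract_eq hi hp]
  have hfC {p : P} (hp : p ∈ C) : f p = 0 :=
    hρ.glue_apply (hCO hp) fun i hi ↦ by rw [(d i).retract_eq hi hp, sub_self]
  obtain ⟨σ, hσ⟩ := exists_idempotent_correction (H →L[ℝ] H)
  refine ⟨{q | q ∈ O ∧ σ (M q) (f q) = 0}, Module.finrank ℝ E - (r - k),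
    fun p hp ↦ ⟨hCO hp, by rw [hfC hp, map_zero]⟩, fun p hp ↦ ?_⟩
  let R := LinearMap.range (A p).toLinearMap
  have hR : FiniteDimensional ℝ R :=
    (hA p).finiteDimensional_range (B.isSkew_sharp p) (hinj p (hCO hp))
  -- `σ (M q) (f q)` takes values in `H`, where `0` is not a regular value in general; composing
  -- with `π` gives a defining function into the finite-dimensional `R`.
  let π : H →L[ℝ] R := (closedProjection R).codRestrict R (closedProjection_mem R)
  have hπ0 (x : H) : π x = 0 ↔ x ∈ Rᗮ := by
    rw [← closedProjection_eq_zero_iff, Subtype.ext_iff]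
    rfl
  have hπM (x : H) : π (M p x) = π x := by
    rw [hMC hp]
    exact Subtype.ext
      (DFunLike.congr_fun (isIdempotentElem_closedProjection R) x)
  have hMid : IsIdempotentElem (M p) := hMC hp ▸ isIdempotentElem_closedProjection R
  obtain ⟨hσM, hσev⟩ := hσ (M p) hMid
  have hMcont := (hM (hCO hp)).continuousAt
  have hev := hMcont.eventually hσev
  have hOp : ∀ᶠ q in 𝓝 p, q ∈ O := hO.mem_nhds (hCO hp)
  let Ψ : P → H →L[ℝ] H := fun q ↦ σ (M q)
  have hΨp : Ψ p = M p := hσM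
  have hΨ : ∀ᶠ q in 𝓝 p, ContMDiffAt 𝓘(ℝ, E) 𝓘(ℝ, H →L[ℝ] H) ∞ Ψ q := by
    filter_upwards [hev, hOp] with q hq hqO
    exact hq.2.contMDiffAt.comp q (hM hqO)
  let g : P → H := fun q ↦ Ψ q (f q)
  have hg : ∀ᶠ q in 𝓝 p, ContMDiffAt 𝓘(ℝ, E) 𝓘(ℝ, H) ∞ g q := by
    filter_upwards [hΨ, hOp] with q hq hqO
    exact hq.clm_apply (hf hqO)
  let G : P → R := fun q ↦ π (g q)
  have hG : ∀ᶠ q in 𝓝 p, ContMDiffAt 𝓘(ℝ, E) 𝓘(ℝ, R) ∞ G q := by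
    filter_upwards [hg] with q hq
    exact π.contMDiff.contMDiffAt.comp q hq
  -- No zeros are added by `π`: if `π (g q) = 0`, then `g q` is fixed by the idempotent `Ψ q` and
  -- killed by `Ψ p`. So `g q = (Ψ q - Ψ p) (g q)` with an operator of norm less than `1`.
  have hzero : ∀ᶠ q in 𝓝 p, (q ∈ {q | q ∈ O ∧ σ (M q) (f q) = 0} ↔ G q = 0) := by
    have hnear : ∀ᶠ q in 𝓝 p, ‖Ψ q - Ψ p‖ < 1 := by
      filter_upwards [hΨ.self_of_nhds.continuousAt.eventually
        (Metric.ball_mem_nhds (Ψ p) one_pos)] with q hq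
      rwa [dist_eq_norm] at hq
    filter_upwards [hev, hOp, hnear] with q hq hqO hqn
    constructor
    · rintro ⟨-, h0⟩
      change π (σ (M q) (f q)) = 0
      rw [h0, map_zero]
    · intro h0
      refine ⟨hqO, ?_⟩
      have h1 : Ψ q (g q) = g q := DFunLike.congr_fun hq.1 (f q)
      have h2 : Ψ p (g q) = 0 := by
        rw [hΨp, hMC hp]
        exact congrArg Subtype.val h0
      have h3 : (Ψ q - Ψ p) (g q) = g q := by
        rw [sub_apply, h1, h2, sub_zero]
      by_contra hne0
      have h4 : 0 < ‖g q‖ := norm_pos_iff.2 hne0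
      have h5 := (Ψ q - Ψ p).le_opNorm (g q)
      rw [h3] at h5
      nlinarith
  -- As `f p = 0`, the derivative of `Ψ` does not contribute. The retractions contribute only
  -- vectors in `dΦ(TC)`, which is orthogonal to `R`.
  have hdG (v : TangentSpace 𝓘(ℝ, E) p) :
      mvfderiv 𝓘(ℝ, E) G p v = π (mvfderiv 𝓘(ℝ, E) Φ p v) := by
    have hχ := IsManifold.chart_mem_maximalAtlas (I := 𝓘(ℝ, E)) (n := ∞) p
    have hpχ := mem_chart_source E p
    set χ := chartAt E p
    have hsymm : χ.symm (χ p) = p := χ.left_inv hpχ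
    have hfd := (hf (hCO hp)).mdifferentiableAt hne
    have h1 := (differentiableAt_comp_symm hχ hpχ hfd).hasFDerivAt
    have h2 := (differentiableAt_comp_symm hχ hpχ
      (hΨ.self_of_nhds.mdifferentiableAt hne)).hasFDerivAt
    have h3 : HasFDerivAt (G ∘ χ.symm) _ (χ p) := π.hasFDerivAt.comp (χ p) (h2.clm_apply h1)
    have h4 : mvfderiv 𝓘(ℝ, E) G p v = π (mvfderiv 𝓘(ℝ, E) f p v) := by
      rw [mvfderiv_eq_fderiv_comp hχ hpχ (hG.self_of_nhds.mdifferentiableAt hne), h3.fderiv,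
        mvfderiv_eq_fderiv_comp hχ hpχ hfd]
      simp [hsymm, hfC hp, hΨp, hπM]
    rw [h4]
    refine hρ.apply_mvfderiv_glue (hCO hp) (fun i hi ↦ (hΦ p (hCO hp)).sub (hΦr i hi))
      (fun i hi ↦ by rw [Function.comp_apply, (d i).retract_eq hi hp, sub_self]) π fun i hi ↦ ?_
    have h5 : mvfderiv 𝓘(ℝ, E) (Φ - Φ ∘ (d i).retract) p v = mvfderiv 𝓘(ℝ, E) Φ p v -
        mvfderiv 𝓘(ℝ, E) (Φ ∘ (d i).retract) p v := by
      rw [mvfderiv_sub ((hΦ p (hCO hp)).mdifferentiableAt hne)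
        ((hΦr i hi).mdifferentiableAt hne)]
      rfl
    have h6 := (d i).mvfderiv_comp_retract_mem hi hp (hΦ p (hCO hp)) v
    have h7 : π (mvfderiv 𝓘(ℝ, E) (Φ ∘ (d i).retract) p v) = 0 := by
      rw [hπ0, Submodule.mem_orthogonal']
      rintro _ ⟨x, rfl⟩
      exact (Submodule.mem_orthogonal _ _).1 ((hA p).apply_mem x) _ h6
    change π (mvfderiv 𝓘(ℝ, E) (Φ - Φ ∘ (d i).retract) p v) = _
    rw [h5, map_sub, h7, sub_zero]
  have hker (v : TangentSpace 𝓘(ℝ, E) p) : mvfderiv 𝓘(ℝ, E) G p v = 0 ↔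
      ∀ x, inner ℝ (A p x) (mvfderiv 𝓘(ℝ, E) Φ p v) = 0 := by
    rw [hdG, hπ0, Submodule.mem_orthogonal]
    exact ⟨fun h x ↦ h _ ⟨x, rfl⟩, fun h _ ⟨x, hx⟩ ↦ hx ▸ h x⟩
  -- A vector `y ∈ R` orthogonal to the image pulls back to the zero covector, and pullback is
  -- injective on the range of `A p`.
  have hsurj : Function.Surjective (mvfderiv 𝓘(ℝ, E) G p) := by
    have h1 : (LinearMap.range (mvfderiv 𝓘(ℝ, E) G p).toLinearMap)ᗮ = ⊥ := by
      rw [eq_bot_iff]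
      intro y hy
      rw [Submodule.mem_orthogonal'] at hy
      have h2 : PoissonLinear.pullbackInner (mvfderiv 𝓘(ℝ, E) Φ p).toLinearMap (y : H) = 0 := by
        ext v
        have h3 := hy _ ⟨v, rfl⟩
        have h4 : inner ℝ (y : H) (closedProjection R (mvfderiv 𝓘(ℝ, E) Φ p v)) = 0 := by
          change inner ℝ y (mvfderiv 𝓘(ℝ, E) G p v) = 0 at h3
          rw [hdG] at h3
          exact h3
        have h5 := (Submodule.mem_orthogonal _ _).1
          (sub_closedProjection_mem R (mvfderiv 𝓘(ℝ, E) Φ p v)) y y.2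
        rw [inner_sub_right, h4, sub_zero] at h5
        exact h5
      refine Subtype.ext ((hA p).eq_zero_of_mem (B.isSkew_sharp p) (hinj p (hCO hp)) y.2 ?_)
      rw [h2]
      exact Submodule.zero_mem _
    exact LinearMap.range_eq_top.1 (Submodule.orthogonal_eq_bot_iff.1 h1)
  obtain ⟨φ, F, hφ, hfin, hφG⟩ := exists_isSliceChart_of_submersion hG hzero hsurj
  have hT (v : TangentSpace 𝓘(ℝ, E) p) : v ∈ F.comap (mvfderiv 𝓘(ℝ, E) φ p).toLinearMap ↔
      ∀ x, inner ℝ (A p x) ((mvfderiv 𝓘(ℝ, E) Φ p).toLinearMap v) = 0 :=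
    (hφG v).trans (hker v)
  refine ⟨φ, F, hφ, ?_, (hA p).inf_eq_bot (B.isSkew_sharp p) (hinj p (hCO hp)) hT,
    (hA p).sup_eq (B.isSkew_sharp p) (hinj p (hCO hp)) hT⟩
  have h1 : Module.finrank ℝ R = r - k := hc p hp
  lia

end

/-! ### The theorem: shrinking the extension to its cosymplectic part. -/

theorem mainTheorem1 {E : Type*} [NormedAddCommGroup E] [NormedSpace ℝ E] [FiniteDimensional ℝ E]
    {P : Type*} [TopologicalSpace P] [T2Space P] [SecondCountableTopology P]
    [ChartedSpace E P] [IsManifold 𝓘(ℝ, E) ∞ P]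
    (B : PoissonStructure E P) (C : Set P) (k : ℕ)
    (hC : IsEmbeddedSubmanifold E C k) (hpre : B.IsPrePoisson C) :
    ∃ (S : Set P) (m : ℕ) (_ : IsEmbeddedSubmanifold E S m) (hCS : C ⊆ S)
      (hS : B.IsCosymplectic S), B.IsCoisotropicIn hCS hS := by
  obtain ⟨S, m, hCS, hS⟩ := hpre.exists_extension hC
  choose φ F hφ hfin hinf hsup using hS
  have hcos (p : P) (hp : p ∈ C) : ∃ N : Set P, IsOpen N ∧ p ∈ N ∧ N ⊆ (φ p hp).source ∧
      ∀ q ∈ N, PoissonLinear.IsCosymplectic (B.sharp q)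
        ((F p hp).comap (mvfderiv 𝓘(ℝ, E) (φ p hp) q).toLinearMap) := by
    have h1 := (hφ p hp).eventually_isCosymplectic B.toBivectorField
      (PoissonLinear.isCosymplectic_of_complement (B.isSkew_sharp p) (hinf p hp) (hsup p hp))
    obtain ⟨N, hN, hNo, hpN⟩ := eventually_nhds_iff.1
      (h1.and ((φ p hp).open_source.mem_nhds (hφ p hp).mem_source))
    exact ⟨N, hNo, hpN, fun q hq ↦ (hN q hq).2, fun q hq ↦ (hN q hq).1⟩
  choose! N hNo hpN hNs hNc using hcos
  -- `S` has slice charts only around points of `C`; on this part each point lies in such a chart,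
  -- where the cosymplectic condition persists.
  let S' : Set P := S ∩ ⋃ p ∈ C, N p
  have hCS' : C ⊆ S' := fun p hp ↦ ⟨hCS hp, Set.mem_biUnion hp (hpN p hp)⟩
  have hslice (p : P) (hp : p ∈ C) (q : P) (hq : q ∈ N p) :
      IsSliceChart S' q ((φ p hp).restr (N p)) (F p hp) := by
    refine ⟨restr_mem_maximalAtlas _ (hφ p hp).mem_maximalAtlas (hNo p hp), ?_, fun q' hq' ↦ ?_⟩
    · rw [(φ p hp).restr_source' _ (hNo p hp)]
      exact ⟨hNs p hp hq, hq⟩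
    · rw [(φ p hp).restr_source' _ (hNo p hp)] at hq'
      have h1 : q' ∈ S' ↔ q' ∈ S := and_iff_left (Set.mem_biUnion hp hq'.2)
      exact h1.trans ((hφ p hp).mem_iff q' hq'.1)
  have htan (p : P) (hp : p ∈ C) (q : P) (hq : q ∈ N p) (hqS : q ∈ S') :
      submanifoldTangent E S' q = (F p hp).comap (mvfderiv 𝓘(ℝ, E) (φ p hp) q).toLinearMap := by
    have h := submanifoldTangent_eq hqS (hslice p hp q hq)
    exact h
  have hmem {q : P} (hq : q ∈ S') : ∃ p ∈ C, q ∈ N p := by simpa using hq.2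
  have hcosymp : B.IsCosymplectic S' := by
    intro q hq
    obtain ⟨p, hp, hqN⟩ := hmem hq
    rw [htan p hp q hqN hq]
    exact hNc p hp q hqN
  refine ⟨S', m, fun q hq ↦ ?_, hCS', hcosymp, fun p hp ↦ ?_⟩
  · obtain ⟨p, hp, hqN⟩ := hmem hq
    exact ⟨_, _, hslice p hp q hqN, hfin p hp⟩
  · refine PoissonLinear.isCoisotropic_of_complement (B.isSkew_sharp p) ?_ (hcosymp p (hCS' hp))
    rw [htan p hp p (hpN p hp) (hCS' hp)]
    exact hsup p hp
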